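/- **Theorem (noiseless input reconstruction).** *Setting.* Let $D\ge 1$, and let $\mathbf V=[\mathbf v_1,\dots,\mathbf v_D]\in\mathbb R^{D\times D}$ have linearly independent columns of Euclidean norm $1$. Let $T_d>0$, $\Omega_d>0$ $(1\le d\le D)$, $\mathbf T=\mathrm{diag}(T_1,\dots,T_D)$, and $\lambda,h,B\in\mathbb R$ with $B>0$ and $N_d^B:=B/T_d\in\mathbb Z$ for $2\le d\le D$. Let $f\in\mathsf{PW}_{\mathbf\Omega}(\mathbb R^D)$, i.e. $f\in L^2(\mathbb R^D)$ is real-valued, continuous (the bandlimited representative), and its Fourier transform $\int f(\mathbf x)e^{-j\langle\boldsymbol\omega,\mathbf x\rangle}d\mathbf x$ vanishes outside $\{\mathbf V^{-\top}\boldsymbol\omega:|\omega_d|<\Omega_d\ \forall d\}$. Write $\|\cdot\|_\infty$ for the $L^\infty$ norm, $\bar{\mathbf x}=(x_2,\dots,x_D)$, $f_{\bar{\mathbf x}}(x_1)=f(\sum_d x_d\mathbf v_d)$, and, for $\mathbf b\in\mathbb Z^{D-1}$, $\mathcal R_{\mathbf b}=\prod_{d=2}^D[b_dB,(b_d+1)B)$.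 *Modulo-hysteresis.* For each $\mathbf b$ let $M_{\mathbf b}=\big\lfloor(\inf_{\bar{\mathbf x}\in\mathcal R_{\mathbf b}}f_{\bar{\mathbf x}}(0)+\lambda)/h\big\rfloor-1$, $\tau_{\mathbf b,0}=s_{\mathbf b,0}=0$, $\varepsilon_{\mathbf b,0}\equiv hM_{\mathbf b}$, and recursively $$\tau_{\mathbf b,r+1}=\inf\Big\{x_1>\tau_{\mathbf b,r}:\sup_{\bar{\mathbf x}\in\mathcal R_{\mathbf b}}|f_{\bar{\mathbf x}}(x_1)-\varepsilon_{\mathbf b,r}(x_1)|=\lambda\Big\},\quad s_{\mathbf b,r+1}=\mathrm{sign}\big[f_{B\mathbf b}(\tau_{\mathbf b,r+1})-\varepsilon_{\mathbf b,r}(\tau_{\mathbf b,r+1})\big],$$ $\varepsilon_{\mathbf b,r+1}=\varepsilon_{\mathbf b,r}+h\,s_{\mathbf b,r+1}\mathbb 1_{[\tau_{\mathbf b,r+1},\infty)}$, up to the first index $R^+_{\mathbf b}$ at which the set in the infimum is empty. For $x_1\ge0$ and $\bar{\mathbf x}\in\mathcal R_{\mathbf b}$ put $\mathscr M^D_{\mathsf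 H}f(\mathbf V\mathbf x)=f(\mathbf V\mathbf x)-h\big[M_{\mathbf b}+\sum_{r=0}^{R^+_{\mathbf b}}s_{\mathbf b,r}\mathbb 1_{[\tau_{\mathbf b,r},\infty)}(x_1)\big]$; for $x_1<0$ put $\mathscr M^D_{\mathsf H}f(\mathbf V\mathbf x)=\mathscr M^D_{\mathsf H}[f^-](\mathbf V(-x_1,\bar{\mathbf x}))$ with $f^-(\mathbf V\mathbf x)=f(\mathbf V(-x_1,\bar{\mathbf x}))$. Let $\gamma[\mathbf k]=f(\mathbf V\mathbf T\mathbf k)$ and $y[\mathbf k]=\mathscr M^D_{\mathsf H}f(\mathbf V\mathbf T\mathbf k)$, $\mathbf k\in\mathbb Z^D$. *Reconstruction.* Let $N\ge1$ be an integer, $\Delta^N[k]=(-1)^{N-k}\binom Nk$ for $0\le k\le N$ and $0$ otherwise, and write $\mathbf k=(k_1,\bar{\mathbf k})$, $\bar{\mathbf T}=\mathrm{diag}(T_2,\dots,T_D)$. Let $\psi_{\mathbf b,m}[\mathbf k]=\Delta^N[k_1-m]/\prod_{d=2}^DN_d^B$ if $\bar{\mathbf T}\bar{\mathbf k}\in\mathcal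 R_{\mathbf b}$, and $0$ otherwise. For $\mathbf b^*=\mathbf b+\mathbf e_{d}$ let $\psi_{\mathbf b,\mathbf b^*}[\mathbf k]=\Delta^N[k_{d}-(N^B_{d}b^*_{d}-1)]/\prod_{i\ge2,\,i\ne d}N_i^B$ if $k_1=0$ and $\bar{\mathbf T}\bar{\mathbf k}\in\mathcal R_{\mathbf b}\cup\mathcal R_{\mathbf b^*}$, and $0$ otherwise. From $y$ compute, for each $\mathbf b$: 1. $\widetilde M_{\mathbf 0}=0$ and $\widetilde M_{\mathbf b^*}-\widetilde M_{\mathbf b}=(-1)^N\mathrm{sign}\langle y,\psi_{\mathbf b,\mathbf b^*}\rangle$ if $|\langle y,\psi_{\mathbf b,\mathbf b^*}\rangle|\ge h/2$, and $=0$ otherwise, propagated from $\mathbf 0$ to $\mathbf b$ along $x_2$, then $x_3$, and so on up to $x_D$; 2. $m^1=\min\{m>0:|\langle y,\psi_{\mathbf b,m}\rangle|\ge h/2\}$ and $m^{r+1}=\min\{m>m^r+N:|\langle y,\psi_{\mathbf b,m}\rangle|\ge h/2\}$, as long as these exist, and $\widetilde s_r=-\mathrm{sign}\langle y,\psi_{\mathbf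 b,m^r}\rangle$. For $\bar{\mathbf T}\bar{\mathbf k}\in\mathcal R_{\mathbf b}$ set $\widetilde\gamma[\mathbf k]=y[\mathbf k]+h\big[\widetilde M_{\mathbf b}+\sum_{r:\,m^r+N\le|k_1|}\widetilde s_r\big]$, where for $k_1<0$ step 2 is applied to the reflected data $(k_1,\bar{\mathbf k})\mapsto y[-k_1,\bar{\mathbf k}]$. *Claim.* Assume $$\|f\|_\infty B\sqrt D\,\|\mathbf\Omega\|_2<\min\{h/2,\,2\lambda-3h\},\qquad (T_d\Omega_d e)^N\|f\|_\infty<h/2\ \ (1\le d\le D),$$ $$(N+1)T_1\,\Omega_1\|f\|_\infty<h,\qquad (N+1)T_d<B\ \ (2\le d\le D).$$ Then $\mathscr M^D_{\mathsf H}f$ is well-defined (in every band, for $f$ and for $f^-$, the recursion ends after finitely many folds), and the reconstruction, which uses only $y,h,B,\mathbf T,N$, is exact: $\widetilde\gamma[\mathbf k]=\gamma[\mathbf k]-hM_{\mathbf 0}$ for all $\mathbf k\in\mathbb Z^D$. -/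

import Mathlib

open MeasureTheory FourierTransform Matrix
open scoped ENNReal

noncomputable section

namespace ModuloHysteresis

/-! Throughout, the dimension is `D = n + 1`. Coordinate `0 : Fin (n + 1)` is the distinguished
direction `x₁`, and coordinates `d.succ`, `d : Fin n`, are the directions `x₂, …, x_D`. -/

/-- Physical space `ℝ^D`, in Cartesian coordinates. -/
abbrev Space (n : ℕ) : Type := EuclideanSpace ℝ (Fin (n + 1))

/-- The point `V x`, whose lattice coordinates are `x`. -/
def latticePoint {n : ℕ} (V : Matrix (Fin (n + 1)) (Fin (n + 1)) ℝ) (x : Fin (n + 1) → ℝ) :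
    Space n :=
  WithLp.toLp 2 (V *ᵥ x)

/-- The point `V T k` of the sampling lattice, where `T = diag (T₁, …, T_D)`. -/
def samplePoint {n : ℕ} (V : Matrix (Fin (n + 1)) (Fin (n + 1)) ℝ) (T : Fin (n + 1) → ℝ)
    (k : Fin (n + 1) → ℤ) : Space n :=
  latticePoint V (Matrix.diagonal T *ᵥ fun d => (k d : ℝ))

/-- The open parallelepiped `{V^{-⊤} ω : |ω_d| < Ω_d for all d}` of angular frequencies. -/
def spectralSet {n : ℕ} (V : Matrix (Fin (n + 1)) (Fin (n + 1)) ℝ) (Ω : Fin (n + 1) → ℝ) :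
    Set (Space n) :=
  {ξ | ∃ ω : Fin (n + 1) → ℝ, (∀ d, |ω d| < Ω d) ∧ ξ = WithLp.toLp 2 ((V⁻¹)ᵀ *ᵥ ω)}

/-- The Paley-Wiener space `PW_Ω(ℝ^D)` relative to the lattice matrix `V`: real functions in
`L²(ℝ^D)`, given by their continuous representative, whose `L²` Fourier transform vanishes almost
everywhere outside `spectralSet V Ω`. Mathlib's transform uses the kernel `exp (-2πi ⟨ξ, x⟩)`, so
that `ξ` corresponds to the angular frequency `2πξ`. -/
structure PaleyWiener {n : ℕ} (V : Matrix (Fin (n + 1)) (Fin (n + 1)) ℝ)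
    (Ω : Fin (n + 1) → ℝ) (f : Space n → ℝ) : Prop where
  continuous : Continuous f
  memLp : MemLp (fun x => (f x : ℂ)) 2 (volume : Measure (Space n))
  spectrum : ∀ᵐ ξ ∂(volume : Measure (Space n)), (2 * Real.pi) • ξ ∉ spectralSet V Ω →
    (𝓕 (memLp.toLp (fun x => (f x : ℂ))) : Lp ℂ 2 (volume : Measure (Space n))) ξ = 0

/-- The norm of `L^∞(ℝ^D)`. -/
def supNorm {n : ℕ} (f : Space n → ℝ) : ℝ :=
  (eLpNorm f ∞ (volume : Measure (Space n))).toReal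

/-! ### The modulo-hysteresis operator

The operator is described on functions `g` of the lattice coordinates, `g x = f (V x)`. -/

/-- The box `R_b = ∏_d [b_d B, (b_d + 1) B)` of the last `D - 1` lattice coordinates. -/
def band {n : ℕ} (B : ℝ) (b : Fin n → ℤ) : Set (Fin n → ℝ) :=
  {x | ∀ d, (b d : ℝ) * B ≤ x d ∧ x d < ((b d : ℝ) + 1) * B}

/-- The index `b` of the band with `x ∈ R_b`. -/
def bandIndex {n : ℕ} (B : ℝ) (x : Fin n → ℝ) : Fin n → ℤ := fun d => ⌊x d / B⌋

/-- The corner `B b` of the box `R_b`. -/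
def bandCorner {n : ℕ} (B : ℝ) (b : Fin n → ℤ) : Fin n → ℝ := fun d => B * (b d : ℝ)

/-- The constant `M_b = ⌊(inf_{x̄ ∈ R_b} f_x̄(0) + λ) / h⌋ - 1`. -/
def bandConst {n : ℕ} (lam h B : ℝ) (g : (Fin (n + 1) → ℝ) → ℝ) (b : Fin n → ℤ) : ℤ :=
  ⌊((⨅ x : band B b, g (Fin.cons 0 x.1)) + lam) / h⌋ - 1

/-- The set of `x₁ > τ` at which `sup_{x̄ ∈ R_b} |f_x̄(x₁) - ε(x₁)| = λ`. -/
def crossings {n : ℕ} (lam B : ℝ) (g : (Fin (n + 1) → ℝ) → ℝ) (b : Fin n → ℤ)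
    (τ : ℝ) (ε : ℝ → ℝ) : Set ℝ :=
  {x₁ | τ < x₁ ∧ (⨆ x : band B b, |g (Fin.cons x₁ x.1) - ε x₁|) = lam}

/-- The data after the `r`-th fold in a band: the folding time `τ_r`, the sign `s_r`, and the
partial residual `ε_r`. -/
structure FoldState where
  time : ℝ
  sgn : ℝ
  residual : ℝ → ℝ

/-- The recursion for the folding times, the signs and the partial residuals in band `b`. The
states with index `r` are meaningful as long as the sets of crossings at all smaller indices are
non-empty. -/
def foldState {n : ℕ} (lam h B : ℝ) (g : (Fin (n + 1) → ℝ) → ℝ) (b : Fin n → ℤ) :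
    ℕ → FoldState
  | 0 => ⟨0, 0, fun _ => h * (bandConst lam h B g b : ℝ)⟩
  | r + 1 =>
    let p := foldState lam h B g b r
    let τ := sInf (crossings lam B g b p.time p.residual)
    let s := Real.sign (g (Fin.cons τ (bandCorner B b)) - p.residual τ)
    ⟨τ, s, fun x₁ => p.residual x₁ + h * s * (Set.Ici τ).indicator 1 x₁⟩

/-- `R` is an index at which the recursion in band `b` ends: there is no further crossing. -/
def FoldsEnd {n : ℕ} (lam h B : ℝ) (g : (Fin (n + 1) → ℝ) → ℝ) (b : Fin n → ℤ) (R : ℕ) : Prop :=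
  crossings lam B g b (foldState lam h B g b R).time (foldState lam h B g b R).residual = ∅

/-- The number `R_b⁺` of folds in band `b` on the half-line `x₁ > 0`. -/
def foldCount {n : ℕ} (lam h B : ℝ) (g : (Fin (n + 1) → ℝ) → ℝ) (b : Fin n → ℤ) : ℕ :=
  sInf {R | FoldsEnd lam h B g b R}

/-- The residual `h (M_b + ∑_{r ≤ R_b⁺} s_r 1_{[τ_r, ∞)}(x₁))` of band `b`, for `x₁ ≥ 0`. -/
def foldResidual {n : ℕ} (lam h B : ℝ) (g : (Fin (n + 1) → ℝ) → ℝ) (b : Fin n → ℤ)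
    (x₁ : ℝ) : ℝ :=
  h * ((bandConst lam h B g b : ℝ) + ∑ r ∈ Finset.range (foldCount lam h B g b + 1),
    (foldState lam h B g b r).sgn * (Set.Ici (foldState lam h B g b r).time).indicator 1 x₁)

/-- The folded function on the half-space `x₁ ≥ 0`. -/
def foldHalf {n : ℕ} (lam h B : ℝ) (g : (Fin (n + 1) → ℝ) → ℝ) (x : Fin (n + 1) → ℝ) : ℝ :=
  g x - foldResidual lam h B g (bandIndex B (Fin.tail x)) (x 0)

/-- The reflection `(x₁, x₂, …, x_D) ↦ (-x₁, x₂, …, x_D)`, on real or integer vectors. -/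
def reflect {n : ℕ} {R : Type} [Neg R] (x : Fin (n + 1) → R) : Fin (n + 1) → R :=
  Fin.cons (-(x 0)) (Fin.tail x)

/-- The folded function in lattice coordinates. On `x₁ < 0` the reflected input is folded. -/
def foldLattice {n : ℕ} (lam h B : ℝ) (g : (Fin (n + 1) → ℝ) → ℝ) (x : Fin (n + 1) → ℝ) : ℝ :=
  if 0 ≤ x 0 then foldHalf lam h B g x
  else foldHalf lam h B (fun x' => g (reflect x')) (reflect x)

/-- The multi-dimensional modulo-hysteresis operator with threshold `lam`, hysteresis `h` and
band width `B`, with respect to the lattice matrix `V`, applied to `f` and evaluated at `p`. -/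
def moduloHysteresis {n : ℕ} (V : Matrix (Fin (n + 1)) (Fin (n + 1)) ℝ) (lam h B : ℝ)
    (f : Space n → ℝ) (p : Space n) : ℝ :=
  foldLattice lam h B (fun x => f (latticePoint V x)) (V⁻¹ *ᵥ p.ofLp)

/-- All foldings in all bands end after finitely many steps, on both half-spaces: the operator is
well-defined at `f`. -/
def WellDefined {n : ℕ} (V : Matrix (Fin (n + 1)) (Fin (n + 1)) ℝ) (lam h B : ℝ)
    (f : Space n → ℝ) : Prop :=
  ∀ b : Fin n → ℤ,
    (∃ R, FoldsEnd lam h B (fun x => f (latticePoint V x)) b R) ∧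
    (∃ R, FoldsEnd lam h B (fun x => f (latticePoint V (reflect x))) b R)

/-! ### The reconstruction

Everything below is computed from the data `y : ℤ^D → ℝ` and from `h`, `B`, `T`, `N` and the
numbers `NB d = B / T_d` of samples along the edges of a band. -/

/-- The sequence `Δ₋^N`: iterated convolution of `Δ₋¹ = δ_{-1} - δ_0` with itself. -/
def diffMinus : ℕ → ℤ → ℝ
  | 0, k => if k = 0 then 1 else 0
  | N + 1, k => diffMinus N (k + 1) - diffMinus N k

/-- The coefficients `Δ^N[k] = Δ₋^N[-k]` of the forward finite difference of order `N`. -/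
def diffCoeff (N : ℕ) (k : ℤ) : ℝ := diffMinus N (-k)

/-- The inner product of two real sequences on `ℤ^D`. -/
def seqInner {n : ℕ} (y ψ : (Fin (n + 1) → ℤ) → ℝ) : ℝ :=
  ∑' k, y k * ψ k

/-- The last `D - 1` lattice coordinates of the sample with index `k`. -/
def sampleTail {n : ℕ} (T : Fin (n + 1) → ℝ) (k : Fin (n + 1) → ℤ) : Fin n → ℝ :=
  fun d => T d.succ * (k d.succ : ℝ)

open Classical in
/-- The filter `ψ_{b,m}`: an `N`-th difference along `x₁` at `m`, averaged over band `b`. -/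
def foldFilter {n : ℕ} (T : Fin (n + 1) → ℝ) (B : ℝ) (NB : Fin n → ℕ) (N : ℕ)
    (b : Fin n → ℤ) (m : ℤ) (k : Fin (n + 1) → ℤ) : ℝ :=
  if sampleTail T k ∈ band B b then diffCoeff N (k 0 - m) / ∏ d, (NB d : ℝ) else 0

/-- The neighbour `b*` of `b` with `b*_d = b_d + 1`. -/
def nextBand {n : ℕ} (b : Fin n → ℤ) (d : Fin n) : Fin n → ℤ :=
  Function.update b d (b d + 1)

open Classical in
/-- The filter `ψ_{b,b*}` for `b* = nextBand b d`: an `N`-th difference along `x_d` in the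
hyperplane `k₁ = 0`, starting at the last sample of band `b` before band `b*`, and averaged over
the directions other than `x₁` and `x_d`. -/
def bandFilter {n : ℕ} (T : Fin (n + 1) → ℝ) (B : ℝ) (NB : Fin n → ℕ) (N : ℕ)
    (b : Fin n → ℤ) (d : Fin n) (k : Fin (n + 1) → ℤ) : ℝ :=
  if k 0 = 0 ∧ sampleTail T k ∈ band B b ∪ band B (nextBand b d) then
    diffCoeff N (k d.succ - ((NB d : ℤ) * nextBand b d d - 1)) /
      ∏ d' ∈ Finset.univ.erase d, (NB d' : ℝ)
  else 0

/-- The estimate of `M_{b*} - M_b` for `b* = nextBand b d`, by thresholding. -/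
def bandJump {n : ℕ} (h B : ℝ) (T : Fin (n + 1) → ℝ) (NB : Fin n → ℕ) (N : ℕ)
    (y : (Fin (n + 1) → ℤ) → ℝ) (b : Fin n → ℤ) (d : Fin n) : ℝ :=
  if h / 2 ≤ |seqInner y (bandFilter T B NB N b d)| then
    (-1) ^ N * Real.sign (seqInner y (bandFilter T B NB N b d))
  else 0

/-- The point `(b₂, …, b_{d-1}, j, 0, …, 0)` on the path of bands from `0` to `b`. -/
def pathBand {n : ℕ} (b : Fin n → ℤ) (d : Fin n) (j : ℤ) : Fin n → ℤ :=
  fun i => if i < d then b i else if i = d then j else 0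

/-- The estimate of `M_b - M_0`, by summing the jumps along the path of bands from `0` to `b`,
one direction after the other. -/
def bandConstEst {n : ℕ} (h B : ℝ) (T : Fin (n + 1) → ℝ) (NB : Fin n → ℕ) (N : ℕ)
    (y : (Fin (n + 1) → ℤ) → ℝ) (b : Fin n → ℤ) : ℝ :=
  ∑ d, (∑ j ∈ Finset.Ico 0 (b d), bandJump h B T NB N y (pathBand b d j) d -
    ∑ j ∈ Finset.Ico (b d) 0, bandJump h B T NB N y (pathBand b d j) d)

/-- The indices `m_min`, for `x₁ > 0`: the first one is the least `m > 0` at which the filtered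
data reach the threshold `h / 2`, the next one is the least such `m` exceeding the previous index
by more than `N`. The value is `⊤` if there is none. -/
def detection {n : ℕ} (h B : ℝ) (T : Fin (n + 1) → ℝ) (NB : Fin n → ℕ) (N : ℕ)
    (y : (Fin (n + 1) → ℤ) → ℝ) (b : Fin n → ℤ) : ℕ → ℕ∞
  | 0 => sInf {i | ∃ m : ℕ, i = (m : ℕ∞) ∧ 0 < m ∧
      h / 2 ≤ |seqInner y (foldFilter T B NB N b m)|}
  | r + 1 => sInf {i | ∃ m : ℕ, i = (m : ℕ∞) ∧ detection h B T NB N y b r + (N : ℕ∞) < (m : ℕ∞) ∧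
      h / 2 ≤ |seqInner y (foldFilter T B NB N b m)|}

open Classical in
/-- The sum of the estimated signs `-sign ⟨y, ψ_{b,m_min}⟩` over all detections whose estimated
folding time `(m_min + N) T₁` is at most `k₁ T₁`. -/
def foldSumEst {n : ℕ} (h B : ℝ) (T : Fin (n + 1) → ℝ) (NB : Fin n → ℕ) (N : ℕ)
    (y : (Fin (n + 1) → ℤ) → ℝ) (b : Fin n → ℤ) (k₁ : ℕ) : ℝ :=
  ∑ᶠ r : ℕ, if detection h B T NB N y b r + (N : ℕ∞) ≤ (k₁ : ℕ∞) then
    -Real.sign (seqInner y (foldFilter T B NB N b ((detection h B T NB N y b r).toNat : ℤ)))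
  else 0

/-- The reconstructed sequence. For `k₁ < 0` the folds are detected in the reflected data. -/
def reconstruct {n : ℕ} (h B : ℝ) (T : Fin (n + 1) → ℝ) (NB : Fin n → ℕ) (N : ℕ)
    (y : (Fin (n + 1) → ℤ) → ℝ) (k : Fin (n + 1) → ℤ) : ℝ :=
  let b := bandIndex B (sampleTail T k)
  y k + h * (bandConstEst h B T NB N y b +
    foldSumEst h B T NB N (if 0 ≤ k 0 then y else fun k' => y (reflect k')) b (k 0).natAbs)

end ModuloHysteresis

end

/-!
The function enters only through `g x = f (V x)`, in lattice coordinates, and only through three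
properties (`BernsteinClass`): it is Lipschitz in the coordinate `d` with the constant
`Ω_d ‖f‖_∞`, its differences of order `N` with step `τ` in that coordinate are at most
`(|τ| Ω_d)^N ‖f‖_∞`, and it tends to zero at infinity. The sharp constants are needed. They come
from Bernstein's inequality (`norm_deriv_expIntegral_le`): the multiplier `a ↦ i a` on `[-W, W]` is
an absolutely convergent series of exponentials with coefficients of total mass `W`, the Fourier
series of a triangle wave, so that the derivative of a band-limited function is a combination of
its translates. That `f` is an integral of exponentials with an integrable spectrum follows from
the `L²` theory, because the spectrum is square integrable with bounded support; the decay is then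
the Riemann-Lebesgue lemma.

Folding (`FoldRegular.settled_step`). Across a band the input varies by some `δ` less than `h / 2`
and `2 λ - 3 h`. After each fold, and at the start by the choice of `M_b`, the folded input is
bounded by `λ - h` on the whole band. The next fold thus needs a change of the input by `h`, which
takes longer than `(N + 1) T₁`. At the fold the whole band is on the same side, at least `λ - δ`
away from zero, so the sign read off at the corner is right and the fold restores the bound
`λ - h`. Since the input decays, the folds come to an end.

Reconstruction. A filter averages differences of order `N` along parallel lines of samples
(`seqInner_eq_sum_fwdDiff`). The part of `f` contributes less than `h / 2`. The residual is a sum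
of steps of height `± h` at times more than `(N + 1) T₁` apart, so that a window sees at most
one of them, and the first window that reaches a step sees it with weight one: the output is then
`∓ h` up to an error below `h / 2`, it is the next detection, and its sign is correct
(`StepData.detection_eq`, `StepData.foldSumEst_eq`). In the same way the filter across the border
of two bands at `k₁ = 0` sees the single step `h (M_{b*} - M_b)`, and this integer difference is at
most one in absolute value (`BernsteinClass.bandJump_eq`). The differences telescope along the path
of bands. The half-space `k₁ < 0` is the same statement for the reflected input.
-/

noncomputable section

namespace ModuloHysteresis

/-! ### Bernstein's inequality for band-limited exponential integrals -/

/-- The weights of the interpolation formula of M. Riesz: the Fourier coefficients of the triangle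
wave which agrees with the identity on `[-1, 1]`. -/
def rieszWeight (n : ℕ) : ℝ := 8 / Real.pi ^ 2 * (Real.sin (Real.pi / 2 * n) / (n : ℝ) ^ 2)

theorem hasSum_rieszWeight_mul_sin {u : ℝ} (hu : |u| ≤ 1) :
    HasSum (fun n : ℕ => rieszWeight n * Real.sin (Real.pi / 2 * n * u)) u := by
  obtain ⟨hu1, hu2⟩ := abs_le.mp hu
  have key : ∀ x ∈ Set.Icc (0 : ℝ) 1,
      HasSum (fun n : ℕ => 1 / (n : ℝ) ^ 2 * Real.cos (2 * Real.pi * n * x))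
        (Real.pi ^ 2 * (x ^ 2 - x + 1 / 6)) := by
    intro x hx
    have e : (Polynomial.map (algebraMap ℚ ℝ) (Polynomial.bernoulli 2)).eval x =
        x ^ 2 - x + 1 / 6 := by
      simp [Polynomial.bernoulli, Finset.sum_range_succ, Polynomial.eval_monomial, bernoulli,
        bernoulli'_two, bernoulli'_one, bernoulli'_zero]
      ring
    have h := hasSum_one_div_nat_pow_mul_cos one_ne_zero hx
    rw [mul_one, e] at h
    convert! h using 1
    rw [show ((Nat.factorial 2 : ℕ) : ℝ) = 2 by norm_num [Nat.factorial]]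
    ring
  have h1 := key (1 / 4 - u / 4) ⟨by linarith, by linarith⟩
  have h2 := key (1 / 4 + u / 4) ⟨by linarith, by linarith⟩
  have h3 := (h1.sub h2).mul_left (4 / Real.pi ^ 2)
  have hpi := Real.pi_ne_zero
  convert! h3 using 1
  · funext n
    have e1 : 2 * Real.pi * n * (1 / 4 - u / 4) = Real.pi / 2 * n - Real.pi / 2 * n * u := by ring
    have e2 : 2 * Real.pi * n * (1 / 4 + u / 4) = Real.pi / 2 * n + Real.pi / 2 * n * u := by ring
    rw [e1, e2, Real.cos_sub, Real.cos_add, rieszWeight]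
    ring
  · field_simp
    ring

/-- At `u = 1` all terms of the Riesz series are nonnegative, so the weights have total mass `1`. -/
theorem hasSum_abs_rieszWeight : HasSum (fun n : ℕ => |rieszWeight n|) 1 := by
  convert hasSum_rieszWeight_mul_sin (u := 1) (by simp) using 2 with n
  have h : Real.sin (Real.pi / 2 * n) = 0 ∨ Real.sin (Real.pi / 2 * n) = 1 ∨
      Real.sin (Real.pi / 2 * n) = -1 := by
    have h1 : Real.sin (Real.pi / 2 * n) * Real.cos (Real.pi / 2 * n) = 0 := by
      have h2 := Real.sin_two_mul (Real.pi / 2 * n)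
      rw [show 2 * (Real.pi / 2 * n) = n * Real.pi by ring, Real.sin_nat_mul_pi] at h2
      linarith
    rcases mul_eq_zero.mp h1 with h2 | h2
    · exact Or.inl h2
    · have h3 := Real.sin_sq_add_cos_sq (Real.pi / 2 * n)
      rw [h2] at h3
      exact Or.inr (sq_eq_one_iff.mp (by linarith))
  rw [mul_one, rieszWeight]
  have h8 : (0 : ℝ) ≤ 8 / Real.pi ^ 2 * (1 / (n : ℝ) ^ 2) := by positivity
  rcases h with h | h | h <;> rw [h]
  · simp
  · rw [mul_one, abs_of_nonneg h8]
  · rw [neg_div, mul_neg, abs_neg, abs_of_nonneg h8]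
    ring

/-- The superposition `∫ c(ξ) exp (i a(ξ) t) dμ(ξ)` of oscillations in the real variable `t`. -/
def expIntegral {X : Type*} [MeasurableSpace X] (μ : Measure X) (c : X → ℂ) (a : X → ℝ)
    (t : ℝ) : ℂ :=
  ∫ ξ, c ξ * Complex.exp (Complex.I * (a ξ * t : ℝ)) ∂μ

section ExpIntegral

variable {X : Type*} [MeasurableSpace X] {μ : Measure X} {c : X → ℂ} {a : X → ℝ} {W M : ℝ}

theorem norm_exp_I_mul_ofReal (x : ℝ) : ‖Complex.exp (Complex.I * (x : ℂ))‖ = 1 := by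
  rw [mul_comm, Complex.norm_exp_ofReal_mul_I]

theorem measurable_exp_I_mul (ha : Measurable a) (t : ℝ) :
    Measurable fun ξ => Complex.exp (Complex.I * (a ξ * t : ℝ)) := by
  fun_prop

theorem integrable_mul_exp (hc : Integrable c μ) (ha : Measurable a) (t : ℝ) :
    Integrable (fun ξ => c ξ * Complex.exp (Complex.I * (a ξ * t : ℝ))) μ := by
  refine hc.mul_bdd (c := 1) (measurable_exp_I_mul ha t).aestronglyMeasurable ?_
  exact Filter.Eventually.of_forall fun ξ => (norm_exp_I_mul_ofReal _).le

theorem hasDerivAt_expIntegral (hc : Integrable c μ) (ha : Measurable a)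
    (hW : ∀ᵐ ξ ∂μ, c ξ ≠ 0 → |a ξ| ≤ W) (t : ℝ) :
    HasDerivAt (expIntegral μ c a)
      (∫ ξ, c ξ * (Complex.I * a ξ * Complex.exp (Complex.I * (a ξ * t : ℝ))) ∂μ) t := by
  refine (hasDerivAt_integral_of_dominated_loc_of_deriv_le (bound := fun ξ => ‖c ξ‖ * W)
    (F := fun t ξ => c ξ * Complex.exp (Complex.I * (a ξ * t : ℝ)))
    (F' := fun t ξ => c ξ * (Complex.I * a ξ * Complex.exp (Complex.I * (a ξ * t : ℝ))))
    Filter.univ_mem ?_ (integrable_mul_exp hc ha t) ?_ ?_ (hc.norm.mul_const W) ?_).2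
  · exact Filter.Eventually.of_forall fun s => (integrable_mul_exp hc ha s).1
  · exact hc.1.mul (Measurable.aestronglyMeasurable (by fun_prop))
  · filter_upwards [hW] with ξ hξ s _
    by_cases h0 : c ξ = 0
    · simp [h0]
    · rw [norm_mul, norm_mul, norm_exp_I_mul_ofReal]
      simpa using mul_le_mul_of_nonneg_left (hξ h0) (norm_nonneg (c ξ))
  · refine Filter.Eventually.of_forall fun ξ s _ => HasDerivAt.const_mul _ ?_
    have h : HasDerivAt (fun s : ℝ => Complex.I * ((a ξ * s : ℝ) : ℂ)) (Complex.I * a ξ) s := by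
      simpa using (((hasDerivAt_id s).const_mul (a ξ)).ofReal_comp).const_mul Complex.I
    simpa [mul_comm] using h.cexp

/-- **Bernstein's inequality**: the derivative is an absolutely convergent combination, of total
weight `W`, of values of the function, by the Riesz series of the multiplier `a ↦ i a` on
`[-W, W]`. -/
theorem norm_deriv_expIntegral_le (hc : Integrable c μ) (ha : Measurable a) (hW0 : 0 < W)
    (hW : ∀ᵐ ξ ∂μ, c ξ ≠ 0 → |a ξ| ≤ W) (hM : ∀ t, ‖expIntegral μ c a t‖ ≤ M) (t : ℝ) :
    ‖∫ ξ, c ξ * (Complex.I * a ξ * Complex.exp (Complex.I * (a ξ * t : ℝ))) ∂μ‖ ≤ W * M := by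
  set p : ℕ → ℝ := fun n => Real.pi / 2 * n / W with hp
  set F : ℕ → X → ℂ := fun n ξ => (W * rieszWeight n / 2 : ℝ) *
    (c ξ * Complex.exp (Complex.I * (a ξ * (t + p n) : ℝ)) -
      c ξ * Complex.exp (Complex.I * (a ξ * (t - p n) : ℝ))) with hF
  have hFint : ∀ n, ∫ ξ, F n ξ ∂μ = (W * rieszWeight n / 2 : ℝ) *
      (expIntegral μ c a (t + p n) - expIntegral μ c a (t - p n)) := by
    intro n
    rw [hF, integral_const_mul, integral_sub (integrable_mul_exp hc ha _)
      (integrable_mul_exp hc ha _)]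
    rfl
  have hsum : HasSum (fun n => ∫ ξ, F n ξ ∂μ)
      (∫ ξ, c ξ * (Complex.I * a ξ * Complex.exp (Complex.I * (a ξ * t : ℝ))) ∂μ) := by
    refine hasSum_integral_of_dominated_convergence
      (fun n ξ => |rieszWeight n| * (W * ‖c ξ‖)) (fun n => ?_) (fun n => ?_) ?_ ?_ ?_
    · exact (((integrable_mul_exp hc ha _).sub (integrable_mul_exp hc ha _)).const_mul _).1
    · refine Filter.Eventually.of_forall fun ξ => ?_
      rw [hF]
      simp only
      rw [norm_mul, Complex.norm_real, Real.norm_eq_abs, abs_div, abs_mul, abs_of_pos hW0,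
        abs_two]
      have h2 : ‖c ξ * Complex.exp (Complex.I * (a ξ * (t + p n) : ℝ)) -
          c ξ * Complex.exp (Complex.I * (a ξ * (t - p n) : ℝ))‖ ≤ 2 * ‖c ξ‖ := by
        refine (norm_sub_le _ _).trans ?_
        rw [norm_mul, norm_mul, norm_exp_I_mul_ofReal, norm_exp_I_mul_ofReal]
        linarith
      calc W * |rieszWeight n| / 2 * _ ≤ W * |rieszWeight n| / 2 * (2 * ‖c ξ‖) := by gcongr
        _ = _ := by ring
    · exact Filter.Eventually.of_forall fun ξ => hasSum_abs_rieszWeight.summable.mul_right _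
    · simp_rw [tsum_mul_right]
      exact (hc.norm.const_mul W).const_mul _
    · filter_upwards [hW] with ξ hξ
      by_cases h0 : c ξ = 0
      · simp [hF, h0, hasSum_zero]
      have hu : |a ξ / W| ≤ 1 := by
        rw [abs_div, abs_of_pos hW0, div_le_one hW0]
        exact hξ h0
      have h1 := (Complex.hasSum_ofReal.mpr (hasSum_rieszWeight_mul_sin hu)).mul_left
        (c ξ * (Complex.I * W * Complex.exp (Complex.I * (a ξ * t : ℝ))))
      convert! h1 using 1
      · funext n
        have e1 : Real.pi / 2 * n * (a ξ / W) = a ξ * p n := by rw [hp]; ring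
        have e2 : Complex.I * (a ξ * (t + p n) : ℝ) =
          Complex.I * (a ξ * t : ℝ) + ((a ξ * p n : ℝ) : ℂ) * Complex.I := by push_cast; ring
        have e3 : Complex.I * (a ξ * (t - p n) : ℝ) =
          Complex.I * (a ξ * t : ℝ) + -((a ξ * p n : ℝ) : ℂ) * Complex.I := by push_cast; ring
        rw [e1, hF]
        simp only
        rw [e2, e3, Complex.exp_add, Complex.exp_add]
        generalize a ξ * p n = θ
        have e4 : ((rieszWeight n * Real.sin θ : ℝ) : ℂ) = rieszWeight n *
            ((Complex.exp (-θ * Complex.I) - Complex.exp (θ * Complex.I)) * Complex.I / 2) := by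
          rw [Complex.ofReal_mul, Complex.ofReal_sin, Complex.sin]
        rw [e4]
        push_cast
        linear_combination (-(c ξ * W * rieszWeight n / 2 *
          Complex.exp (Complex.I * (a ξ * t))) * (Complex.exp (-θ * Complex.I) -
          Complex.exp (θ * Complex.I))) * Complex.I_sq
      · have hWC : (W : ℂ) ≠ 0 := Complex.ofReal_ne_zero.mpr hW0.ne'
        push_cast
        field_simp
  have hb : HasSum (fun n : ℕ => |rieszWeight n| * (W * M)) (1 * (W * M)) :=
    hasSum_abs_rieszWeight.mul_right _
  rw [← hsum.tsum_eq, ← one_mul (W * M)]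
  refine tsum_of_norm_bounded hb fun n => ?_
  rw [hFint, norm_mul, Complex.norm_real, Real.norm_eq_abs, abs_div, abs_mul, abs_of_pos hW0,
    abs_two]
  have h2 := (norm_sub_le (expIntegral μ c a (t + p n)) (expIntegral μ c a (t - p n))).trans
    (add_le_add (hM _) (hM _))
  calc W * |rieszWeight n| / 2 * _ ≤ W * |rieszWeight n| / 2 * (M + M) := by gcongr
    _ = _ := by ring

theorem norm_expIntegral_sub_le (hc : Integrable c μ) (ha : Measurable a) (hW0 : 0 < W)
    (hW : ∀ᵐ ξ ∂μ, c ξ ≠ 0 → |a ξ| ≤ W) (hM : ∀ t, ‖expIntegral μ c a t‖ ≤ M) (s t : ℝ) :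
    ‖expIntegral μ c a t - expIntegral μ c a s‖ ≤ W * M * |t - s| := by
  have h := Convex.norm_image_sub_le_of_norm_hasDerivWithin_le (s := Set.univ) (x := s) (y := t)
    (fun x _ => (hasDerivAt_expIntegral hc ha hW x).hasDerivWithinAt)
    (fun x _ => norm_deriv_expIntegral_le hc ha hW0 hW hM x) convex_univ trivial trivial
  simpa using h

/-- Differences of order `N` at step `τ` are bounded by iterating Bernstein's inequality, since the
difference of an exponential integral is again one, with the same frequencies. -/
theorem norm_fwdDiff_iter_expIntegral_le (hc : Integrable c μ) (ha : Measurable a) (hW0 : 0 < W)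
    (hW : ∀ᵐ ξ ∂μ, c ξ ≠ 0 → |a ξ| ≤ W) (hM : ∀ t, ‖expIntegral μ c a t‖ ≤ M) (τ : ℝ) (N : ℕ)
    (t : ℝ) :
    ‖(fwdDiff τ)^[N] (expIntegral μ c a) t‖ ≤ (|τ| * W) ^ N * M := by
  induction N generalizing c M t with
  | zero => simpa using hM t
  | succ N ih =>
    set c' : X → ℂ := fun ξ => c ξ * (Complex.exp (Complex.I * (a ξ * τ : ℝ)) - 1) with hc'
    have hc'i : Integrable c' μ := by
      have := (integrable_mul_exp hc ha τ).sub hc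
      refine this.congr (Filter.Eventually.of_forall fun ξ => ?_)
      simp only [hc', Pi.sub_apply]
      ring
    have hd : fwdDiff τ (expIntegral μ c a) = expIntegral μ c' a := by
      funext s
      rw [fwdDiff, expIntegral, expIntegral, expIntegral,
        ← integral_sub (integrable_mul_exp hc ha _) (integrable_mul_exp hc ha _)]
      refine integral_congr_ae (Filter.Eventually.of_forall fun ξ => ?_)
      simp only [hc']
      rw [mul_add, Complex.ofReal_add, mul_add, Complex.exp_add]
      ring
    rw [Function.iterate_succ_apply, hd]
    have hW' : ∀ᵐ ξ ∂μ, c' ξ ≠ 0 → |a ξ| ≤ W := by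
      filter_upwards [hW] with ξ hξ h0
      exact hξ (left_ne_zero_of_mul h0)
    have hM' : ∀ s, ‖expIntegral μ c' a s‖ ≤ |τ| * W * M := by
      intro s
      rw [← hd, fwdDiff]
      refine (norm_expIntegral_sub_le hc ha hW0 hW hM s (s + τ)).trans (le_of_eq ?_)
      rw [add_sub_cancel_left]
      ring
    refine (ih hc'i hW' hM' t).trans (le_of_eq ?_)
    ring

end ExpIntegral

/-! ### The Fourier representation of Paley-Wiener functions -/

section FourierRepresentation

variable {n : ℕ} {V : Matrix (Fin (n + 1)) (Fin (n + 1)) ℝ} {Ω : Fin (n + 1) → ℝ}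
  {f : Space n → ℝ}

/-- The angular frequency in lattice coordinates: `2π ⟨ξ, V x⟩ = ⟨latticeFreq V ξ, x⟩`. -/
def latticeFreq (V : Matrix (Fin (n + 1)) (Fin (n + 1)) ℝ) (ξ : Space n) : Fin (n + 1) → ℝ :=
  Vᵀ *ᵥ ((2 * Real.pi) • ξ).ofLp

theorem measurable_latticeFreq (V : Matrix (Fin (n + 1)) (Fin (n + 1)) ℝ) (d : Fin (n + 1)) :
    Measurable fun ξ => latticeFreq V ξ d := by
  refine Continuous.measurable ?_
  unfold latticeFreq Matrix.mulVec dotProduct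
  fun_prop

theorem latticeFreq_dotProduct (ξ : Space n) (x : Fin (n + 1) → ℝ) :
    latticeFreq V ξ ⬝ᵥ x = 2 * Real.pi * inner ℝ ξ (latticePoint V x) := by
  rw [latticeFreq, latticePoint, Matrix.mulVec_transpose, ← Matrix.dotProduct_mulVec,
    WithLp.ofLp_smul, smul_dotProduct, smul_eq_mul, EuclideanSpace.inner_eq_star_dotProduct,
    dotProduct_comm]
  simp

theorem isUnit_det_of_linearIndependent_col (hV : LinearIndependent ℝ V.col) : IsUnit V.det :=
  (Matrix.isUnit_iff_isUnit_det V).mp (Matrix.linearIndependent_cols_iff_isUnit.mp hV)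

theorem abs_latticeFreq_lt (hV : IsUnit V.det) {ξ : Space n}
    (hξ : (2 * Real.pi) • ξ ∈ spectralSet V Ω) (d : Fin (n + 1)) : |latticeFreq V ξ d| < Ω d := by
  obtain ⟨ω, hω, h⟩ := hξ
  rw [latticeFreq, h]
  simp only [Matrix.mulVec_mulVec, ← Matrix.transpose_mul, Matrix.nonsing_inv_mul V hV,
    Matrix.transpose_one, Matrix.one_mulVec]
  exact hω d

theorem isBounded_spectralSet (V : Matrix (Fin (n + 1)) (Fin (n + 1)) ℝ) (Ω : Fin (n + 1) → ℝ) :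
    Bornology.IsBounded (spectralSet V Ω) := by
  have hc : IsCompact ((fun ω : Fin (n + 1) → ℝ => (WithLp.toLp 2 ((V⁻¹)ᵀ *ᵥ ω) : Space n)) ''
      (Set.univ.pi fun d => Set.Icc (-Ω d) (Ω d))) := by
    refine (isCompact_univ_pi fun d => isCompact_Icc).image ?_
    fun_prop
  refine hc.isBounded.subset ?_
  rintro ξ ⟨ω, hω, rfl⟩
  exact ⟨ω, fun d _ => abs_le.mp (hω d).le, rfl⟩

/-- A square integrable spectrum with bounded support is integrable. -/
theorem PaleyWiener.exists_integrable_spectrum (hf : PaleyWiener V Ω f) :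
    ∃ c : Space n → ℂ, Integrable c ∧
      (∀ᵐ ξ, c ξ ≠ 0 → (2 * Real.pi) • ξ ∈ spectralSet V Ω) ∧
      ∀ x, (f x : ℂ) = 𝓕⁻ c x := by
  set F := hf.memLp.toLp (fun x => (f x : ℂ)) with hF
  set c : Lp ℂ 2 (volume : Measure (Space n)) := 𝓕 F with hc
  have hsupp : ∀ᵐ ξ, c ξ ≠ 0 → (2 * Real.pi) • ξ ∈ spectralSet V Ω := by
    filter_upwards [hf.spectrum] with ξ hξ h0
    by_contra h
    exact h0 (hξ h)
  have hci : Integrable c := by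
    obtain ⟨R, hR⟩ := (isBounded_spectralSet V Ω).subset_closedBall 0
    set S : Set (Space n) := Metric.closedBall 0 (R / (2 * Real.pi)) with hS
    have h1 : IntegrableOn c S := by
      have : IsFiniteMeasure (volume.restrict S) :=
        ⟨by rw [Measure.restrict_apply_univ]; exact measure_closedBall_lt_top⟩
      exact (((Lp.memLp c).restrict S).mono_exponent one_le_two).integrable le_rfl
    refine h1.integrable_of_ae_notMem_eq_zero ?_
    filter_upwards [hsupp] with ξ hξ hξS
    by_contra h0
    have h2 := hR (hξ h0)
    rw [mem_closedBall_zero_iff, norm_smul, Real.norm_of_nonneg Real.two_pi_pos.le] at h2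
    refine hξS (mem_closedBall_zero_iff.mpr ?_)
    rw [le_div_iff₀ Real.two_pi_pos]
    linarith
  have hL : Continuous fun p : Space n × Space n => (-innerₗ (Space n)) p.1 p.2 :=
    continuous_inner.neg
  have hcont : Continuous (𝓕⁻ (c : Space n → ℂ)) := by
    have h := VectorFourier.fourierIntegral_continuous (μ := volume) (L := -innerₗ (Space n))
      Real.continuous_fourierChar hL hci
    convert! h using 1
  refine ⟨c, hci, hsupp, ?_⟩
  have hfc : Continuous fun x => (f x : ℂ) := Complex.continuous_ofReal.comp hf.continuous
  refine congrFun (hfc.ae_eq_iff_eq volume hcont |>.mp ?_)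
  refine ae_eq_of_integral_contDiff_smul_eq hfc.locallyIntegrable hcont.locallyIntegrable ?_
  intro g g_smooth g_cpt
  have hg₁ : HasCompactSupport (Complex.ofRealCLM ∘ g) := g_cpt.comp_left rfl
  have hg₂ : ContDiff ℝ (⊤ : ℕ∞) (Complex.ofRealCLM ∘ g) := Complex.ofRealCLM.contDiff.comp g_smooth
  set φ := hg₁.toSchwartzMap hg₂ with hφ
  have h1 := congrArg (fun u => u φ) (MeasureTheory.Lp.fourierInv_toTemperedDistribution_eq c)
  simp only [TemperedDistribution.fourierInv_apply, Lp.toTemperedDistribution_apply] at h1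
  rw [hc, FourierTransform.fourierInv_fourier_eq, ← hc] at h1
  calc ∫ x, g x • (f x : ℂ) = ∫ x, φ x • F x := by
        refine integral_congr_ae ?_
        filter_upwards [hf.memLp.coeFn_toLp] with x hx
        rw [hF, hx]
        simp [hφ]
    _ = ∫ x, (𝓕⁻ φ : SchwartzMap (Space n) ℂ) x • c x := h1.symm
    _ = ∫ x, φ x • 𝓕⁻ (c : Space n → ℂ) x := by
        have h := VectorFourier.integral_fourierIntegral_smul_eq_flip (μ := volume) (ν := volume)
          (L := -innerₗ (Space n))
          Real.continuous_fourierChar hL φ.integrable hci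
        convert! h using 1
        · refine integral_congr_ae (Filter.Eventually.of_forall fun ξ => ?_)
          simp only
          rw [SchwartzMap.fourierInv_coe, Real.fourierInv_eq, VectorFourier.fourierIntegral]
          simp
        · refine integral_congr_ae (Filter.Eventually.of_forall fun ξ => ?_)
          simp only
          rw [Real.fourierInv_eq, VectorFourier.fourierIntegral]
          simp [real_inner_comm]
    _ = ∫ x, g x • 𝓕⁻ (c : Space n → ℂ) x := by simp [hφ]

end FourierRepresentation

/-! ### Regularity in lattice coordinates -/

/-- The properties of a function of the lattice coordinates that the reconstruction relies on:
Bernstein's inequality in each coordinate, as a Lipschitz bound and as a bound for differences of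
every order and step, and decay at infinity. The constants are the bandwidths `Ω` and a bound `M`
for the function. -/
structure BernsteinClass {n : ℕ} (Ω : Fin (n + 1) → ℝ) (M : ℝ)
    (g : (Fin (n + 1) → ℝ) → ℝ) : Prop where
  abs_sub_le : ∀ d x s t,
    |g (Function.update x d t) - g (Function.update x d s)| ≤ Ω d * M * |t - s|
  abs_fwdDiff_le : ∀ d x τ N t,
    |(fwdDiff τ)^[N] (fun s => g (Function.update x d s)) t| ≤ (|τ| * Ω d) ^ N * M
  tendsto_zero : Filter.Tendsto g (Filter.cocompact _) (nhds 0)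

theorem ofReal_fwdDiff_iter {A : Type*} [AddCommMonoid A] (τ : A) (N : ℕ) (u : A → ℝ) (t : A) :
    (((fwdDiff τ)^[N] u t : ℝ) : ℂ) = (fwdDiff τ)^[N] (fun s => (u s : ℂ)) t := by
  induction N generalizing u with
  | zero => rfl
  | succ N ih =>
    rw [Function.iterate_succ_apply, ih, Function.iterate_succ_apply]
    simp only [fwdDiff, Complex.ofReal_sub]
    rfl

section LatticeCoordinates

variable {n : ℕ} {V : Matrix (Fin (n + 1)) (Fin (n + 1)) ℝ} {Ω : Fin (n + 1) → ℝ}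
  {f : Space n → ℝ}

theorem PaleyWiener.abs_le_supNorm (hf : PaleyWiener V Ω f) (x : Space n) :
    |f x| ≤ supNorm f := by
  obtain ⟨c, hc, -, hfc⟩ := hf.exists_integrable_spectrum
  have hb : ∀ x, ‖f x‖ ≤ ∫ ξ, ‖c ξ‖ := by
    intro x
    rw [← Complex.norm_real, hfc, Real.fourierInv_eq]
    refine (norm_integral_le_integral_norm _).trans (le_of_eq ?_)
    simp only [Circle.norm_smul]
  have hfin : eLpNorm f ∞ (volume : Measure (Space n)) ≠ ∞ :=
    (memLp_top_of_bound hf.continuous.aestronglyMeasurable _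
      (Filter.Eventually.of_forall hb)).eLpNorm_ne_top
  have hae : ∀ᵐ x, |f x| ≤ supNorm f := by
    filter_upwards [ae_le_eLpNormEssSup (f := f) (μ := (volume : Measure (Space n)))] with x hx
    rw [← eLpNorm_exponent_top] at hx
    have h := ENNReal.toReal_mono hfin hx
    simpa [supNorm] using h
  have hcl : IsClosed {x | |f x| ≤ supNorm f} :=
    isClosed_le hf.continuous.abs continuous_const
  have h : {x | |f x| ≤ supNorm f} = Set.univ :=
    hcl.ae_eq_univ_iff_eq.mp (Filter.eventuallyEq_univ.mpr hae)
  exact Set.eq_univ_iff_forall.mp h x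

theorem dotProduct_update {ι : Type*} [Fintype ι] [DecidableEq ι] (a x : ι → ℝ) (d : ι) (t : ℝ) :
    a ⬝ᵥ Function.update x d t = a ⬝ᵥ Function.update x d 0 + a d * t := by
  have h : Function.update x d t = Function.update x d 0 + Pi.single d t := by
    funext i
    by_cases hi : i = d
    · subst hi; simp
    · simp [hi]
  rw [h, dotProduct_add, dotProduct_single]

/-- Along a coordinate line in lattice coordinates a function with integrable spectrum is an
exponential integral. -/
theorem fourierInv_latticePoint_update (c : Space n → ℂ) (x : Fin (n + 1) → ℝ) (d : Fin (n + 1))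
    (t : ℝ) : 𝓕⁻ c (latticePoint V (Function.update x d t)) =
      expIntegral volume
        (fun ξ => c ξ * Complex.exp
          (Complex.I * (latticeFreq V ξ ⬝ᵥ Function.update x d 0 : ℝ)))
        (fun ξ => latticeFreq V ξ d) t := by
  rw [Real.fourierInv_eq', expIntegral]
  refine integral_congr_ae (Filter.Eventually.of_forall fun ξ => ?_)
  simp only
  rw [← latticeFreq_dotProduct, dotProduct_update, smul_eq_mul, mul_assoc, ← Complex.exp_add,
    mul_comm]
  congr 2
  push_cast
  ring

theorem tendsto_latticePoint_cocompact (hV : IsUnit V.det) :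
    Filter.Tendsto (latticePoint V) (Filter.cocompact _) (Filter.cocompact _) := by
  have hW : Continuous fun p : Space n => V⁻¹ *ᵥ p.ofLp := by fun_prop
  refine Filter.Tendsto.mono_right (Filter.tendsto_comap_iff.mpr ?_)
    (Filter.comap_cocompact_le hW)
  have : (fun p : Space n => V⁻¹ *ᵥ p.ofLp) ∘ latticePoint V = id := by
    funext x
    simp [latticePoint, Matrix.mulVec_mulVec, Matrix.nonsing_inv_mul V hV]
  rw [this]
  exact Filter.tendsto_id

theorem PaleyWiener.bernsteinClass (hf : PaleyWiener V Ω f) (hV : IsUnit V.det)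
    (hΩ : ∀ d, 0 < Ω d) :
    BernsteinClass Ω (supNorm f) fun x => f (latticePoint V x) := by
  obtain ⟨c, hc, hsupp, hfc⟩ := hf.exists_integrable_spectrum
  have hci : ∀ x d, Integrable (fun ξ => c ξ * Complex.exp
      (Complex.I * (latticeFreq V ξ ⬝ᵥ Function.update x d 0 : ℝ))) := by
    intro x d
    have hm : Measurable fun ξ => latticeFreq V ξ ⬝ᵥ Function.update x d 0 := by
      unfold dotProduct
      exact Finset.measurable_sum _ fun i _ => (measurable_latticeFreq V i).mul_const _
    simpa using integrable_mul_exp hc hm 1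
  have hW : ∀ x d, ∀ᵐ ξ, c ξ * Complex.exp
      (Complex.I * (latticeFreq V ξ ⬝ᵥ Function.update x d 0 : ℝ)) ≠ 0 →
      |latticeFreq V ξ d| ≤ Ω d := by
    intro x d
    filter_upwards [hsupp] with ξ hξ h0
    exact (abs_latticeFreq_lt hV (hξ (left_ne_zero_of_mul h0)) d).le
  have hfe : ∀ x d t, (f (latticePoint V (Function.update x d t)) : ℂ) = expIntegral volume
      (fun ξ => c ξ * Complex.exp (Complex.I * (latticeFreq V ξ ⬝ᵥ Function.update x d 0 : ℝ)))
      (fun ξ => latticeFreq V ξ d) t := by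
    intro x d t
    rw [hfc, fourierInv_latticePoint_update]
  have hM : ∀ x d t, ‖expIntegral volume
      (fun ξ => c ξ * Complex.exp (Complex.I * (latticeFreq V ξ ⬝ᵥ Function.update x d 0 : ℝ)))
      (fun ξ => latticeFreq V ξ d) t‖ ≤ supNorm f := by
    intro x d t
    rw [← hfe, Complex.norm_real]
    exact hf.abs_le_supNorm _
  refine ⟨fun d x s t => ?_, fun d x τ N t => ?_, ?_⟩
  · have h := norm_expIntegral_sub_le (hci x d) (measurable_latticeFreq V d) (hΩ d) (hW x d)
      (hM x d) s t
    rwa [← hfe, ← hfe, ← Complex.ofReal_sub, Complex.norm_real] at h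
  · have h := norm_fwdDiff_iter_expIntegral_le (hci x d) (measurable_latticeFreq V d) (hΩ d)
      (hW x d) (hM x d) τ N t
    rwa [← funext (hfe x d), ← ofReal_fwdDiff_iter, Complex.norm_real] at h
  · have h1 : Filter.Tendsto f (Filter.cocompact _) (nhds 0) := by
      have h2 := (tendsto_integral_exp_inner_smul_cocompact c).comp
        (Homeomorph.neg (Space n)).isClosedEmbedding.tendsto_cocompact
      rw [tendsto_zero_iff_norm_tendsto_zero] at h2 ⊢
      convert! h2 using 2 with x
      rw [← Complex.norm_real, hfc, Real.fourierInv_eq]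
      simp
    exact h1.comp (tendsto_latticePoint_cocompact hV)

end LatticeCoordinates

/-! ### The folding recursion in one band -/

/-- The situation of the folding recursion in band `b`: `K` is a Lipschitz constant of the input in
the folding direction, uniform over the band, and `δ` bounds its variation across the band. -/
structure FoldRegular {n : ℕ} (lam h B : ℝ) (g : (Fin (n + 1) → ℝ) → ℝ) (b : Fin n → ℤ)
    (K δ : ℝ) : Prop where
  B_pos : 0 < B
  h_pos : 0 < h
  lip : ∀ x ∈ band B b, ∀ s t, |g (Fin.cons t x) - g (Fin.cons s x)| ≤ K * |t - s|
  var : ∀ t, ∀ x ∈ band B b, ∀ x' ∈ band B b, |g (Fin.cons t x) - g (Fin.cons t x')| ≤ δ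
  lt_half : δ < h / 2
  lt_thresh : δ < 2 * lam - 3 * h
  decay : ∀ η > 0, ∃ X : ℝ, ∀ t > X, ∀ x ∈ band B b, |g (Fin.cons t x)| < η

/-- The state reached by the recursion after a fold at time `τ`: the residual is constant from `τ`
on, equal to a value `e` for which the folded input is at least `h` below the threshold. -/
def Settled {n : ℕ} (lam h B : ℝ) (g : (Fin (n + 1) → ℝ) → ℝ) (b : Fin n → ℤ)
    (p : FoldState) (e : ℝ) : Prop :=
  (∀ t, p.time ≤ t → p.residual t = e) ∧ ∀ x ∈ band B b, |g (Fin.cons p.time x) - e| ≤ lam - h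

theorem bandCorner_mem_band {n : ℕ} {B : ℝ} (hB : 0 < B) (b : Fin n → ℤ) :
    bandCorner B b ∈ band B b := by
  intro d
  rw [bandCorner]
  constructor <;> nlinarith

namespace FoldRegular

variable {n : ℕ} {lam h B K δ : ℝ} {g : (Fin (n + 1) → ℝ) → ℝ} {b : Fin n → ℤ}

theorem delta_nonneg (H : FoldRegular lam h B g b K δ) : 0 ≤ δ :=
  (abs_nonneg _).trans (H.var 0 _ (bandCorner_mem_band H.B_pos b) _ (bandCorner_mem_band H.B_pos b))

theorem nonempty_band (H : FoldRegular lam h B g b K δ) : Nonempty (band B b) :=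
  ⟨⟨_, bandCorner_mem_band H.B_pos b⟩⟩

theorem lip_nonneg (H : FoldRegular lam h B g b K δ) : 0 ≤ K := by
  have := (abs_nonneg _).trans (H.lip _ (bandCorner_mem_band H.B_pos b) 0 1)
  simpa using this

theorem bddAbove_abs_sub (H : FoldRegular lam h B g b K δ) (t e : ℝ) :
    BddAbove (Set.range fun x : band B b => |g (Fin.cons t x.1) - e|) := by
  refine ⟨|g (Fin.cons t (bandCorner B b)) - e| + δ, ?_⟩
  rintro _ ⟨x, rfl⟩
  have h1 := H.var t x.1 x.2 _ (bandCorner_mem_band H.B_pos b)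
  have h2 := abs_sub_le (g (Fin.cons t x.1)) (g (Fin.cons t (bandCorner B b))) e
  simp only
  linarith

theorem iSup_abs_sub_le (H : FoldRegular lam h B g b K δ) (s t e : ℝ) :
    (⨆ x : band B b, |g (Fin.cons t x.1) - e|) ≤
      (⨆ x : band B b, |g (Fin.cons s x.1) - e|) + K * |t - s| := by
  have := H.nonempty_band
  refine ciSup_le fun x => ?_
  have h1 := le_ciSup (H.bddAbove_abs_sub s e) x
  have h2 := H.lip x.1 x.2 s t
  have h3 := abs_sub_le (g (Fin.cons t x.1)) (g (Fin.cons s x.1)) e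
  linarith

theorem continuous_iSup_abs_sub (H : FoldRegular lam h B g b K δ) (e : ℝ) :
    Continuous fun t => ⨆ x : band B b, |g (Fin.cons t x.1) - e| := by
  have hK := H.lip_nonneg
  refine (LipschitzWith.of_dist_le_mul (K := ⟨K, hK⟩) fun t s => ?_).continuous
  rw [Real.dist_eq, Real.dist_eq, abs_le]
  have h1 := H.iSup_abs_sub_le s t e
  have h2 := H.iSup_abs_sub_le t s e
  rw [abs_sub_comm s t] at h2
  change -(K * |t - s|) ≤ _ ∧ _ ≤ K * |t - s|
  constructor <;> linarith

theorem settled_zero (H : FoldRegular lam h B g b K δ) :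
    Settled lam h B g b (foldState lam h B g b 0) (h * (bandConst lam h B g b : ℝ)) := by
  refine ⟨fun t _ => rfl, fun x hx => ?_⟩
  have := H.nonempty_band
  have hh := H.h_pos
  have hthr := H.lt_thresh
  change |g (Fin.cons 0 x) - _| ≤ _
  rw [bandConst]
  set a := ⨅ x : band B b, g (Fin.cons 0 x.1) with ha
  have hbdd : BddBelow (Set.range fun x : band B b => g (Fin.cons 0 x.1)) := by
    refine ⟨g (Fin.cons 0 x) - δ, ?_⟩
    rintro _ ⟨x', rfl⟩
    have h1 := abs_le.mp (H.var 0 x hx x'.1 x'.2)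
    simp only
    linarith
  have h1 : a ≤ g (Fin.cons 0 x) := ciInf_le hbdd ⟨x, hx⟩
  have h2 : g (Fin.cons 0 x) - δ ≤ a := by
    refine le_ciInf fun x' => ?_
    have h1 := abs_le.mp (H.var 0 x hx x'.1 x'.2)
    linarith
  have h3 := Int.floor_le ((a + lam) / h)
  have h4 := Int.lt_floor_add_one ((a + lam) / h)
  rw [le_div_iff₀ hh] at h3
  rw [div_lt_iff₀ hh] at h4
  push_cast
  rw [abs_le]
  constructor <;> linarith

/-- One step of the recursion. The first crossing comes no sooner than the input can move by `h`.
There the whole band lies on one side, because the input varies by less than `h / 2 < λ` across it;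
this makes the sign taken at the corner the right one for every point of the band. -/
theorem settled_step (H : FoldRegular lam h B g b K δ) {r : ℕ} {e : ℝ}
    (hs : Settled lam h B g b (foldState lam h B g b r) e)
    (hne : ¬FoldsEnd lam h B g b r) :
    h ≤ K * ((foldState lam h B g b (r + 1)).time - (foldState lam h B g b r).time) ∧
    (foldState lam h B g b r).time < (foldState lam h B g b (r + 1)).time ∧
    ((foldState lam h B g b (r + 1)).sgn = 1 ∨ (foldState lam h B g b (r + 1)).sgn = -1) ∧
    (⨆ x : band B b, |g (Fin.cons (foldState lam h B g b (r + 1)).time x.1) - e|) = lam ∧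
    Settled lam h B g b (foldState lam h B g b (r + 1))
      (e + h * (foldState lam h B g b (r + 1)).sgn) := by
  have := H.nonempty_band
  have hh := H.h_pos
  have hthr := H.lt_thresh
  have hhalf := H.lt_half
  have hδ := H.delta_nonneg
  rw [FoldsEnd] at hne
  simp only [foldState]
  set p := foldState lam h B g b r with hp
  obtain ⟨hres, hset⟩ := hs
  set F : ℝ → ℝ := fun t => ⨆ x : band B b, |g (Fin.cons t x.1) - e| with hF
  have hFτ : F p.time ≤ lam - h := ciSup_le fun x => hset x.1 x.2
  have hcr : crossings lam B g b p.time p.residual = {t | p.time ≤ t ∧ F t = lam} := by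
    ext t
    simp only [crossings, Set.mem_ofPred_eq]
    constructor
    · rintro ⟨h1, h2⟩
      rw [hres t h1.le] at h2
      exact ⟨h1.le, h2⟩
    · rintro ⟨h1, h2⟩
      rw [hres t h1]
      refine ⟨lt_of_le_of_ne h1 fun heq => ?_, h2⟩
      rw [← heq] at h2
      linarith
  have hcl : IsClosed {t | p.time ≤ t ∧ F t = lam} :=
    isClosed_Ici.inter (isClosed_eq (H.continuous_iSup_abs_sub e) continuous_const)
  have hmem : sInf (crossings lam B g b p.time p.residual) ∈ {t | p.time ≤ t ∧ F t = lam} := by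
    rw [← Ne, ← Set.nonempty_iff_ne_empty] at hne
    rw [hcr] at hne ⊢
    exact hcl.csInf_mem hne ⟨p.time, fun t ht => ht.1⟩
  set τ := sInf (crossings lam B g b p.time p.residual) with hτ
  obtain ⟨hτle, hFτ'⟩ := hmem
  have hgap : h ≤ K * (τ - p.time) := by
    have h1 : F τ ≤ F p.time + K * |τ - p.time| := H.iSup_abs_sub_le p.time τ e
    rw [abs_of_nonneg (by linarith)] at h1
    linarith
  have hlt : p.time < τ := by
    refine lt_of_le_of_ne hτle fun heq => ?_
    rw [← heq, sub_self, mul_zero] at hgap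
    linarith
  have hle : ∀ x ∈ band B b, |g (Fin.cons τ x) - e| ≤ lam := fun x hx =>
    hFτ' ▸ le_ciSup (H.bddAbove_abs_sub τ e) ⟨x, hx⟩
  -- the supremum need not be attained on the half-open band: `η` is the room left by `δ`
  set η : ℝ := min (h / 2 - δ) (2 * lam - 3 * h - δ) with hη
  have hη0 : 0 < η := lt_min (by linarith) (by linarith)
  have hη1 : η ≤ h / 2 - δ := min_le_left _ _
  have hη2 : η ≤ 2 * lam - 3 * h - δ := min_le_right _ _
  obtain ⟨⟨x₀, hx₀⟩, hx₀'⟩ : ∃ x : band B b, lam - η < |g (Fin.cons τ x.1) - e| :=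
    exists_lt_of_lt_ciSup (by change lam - η < F τ; linarith)
  simp only at hx₀'
  have hcorner := bandCorner_mem_band H.B_pos b
  rw [hres τ hτle]
  have hside : ∃ s : ℝ, (s = 1 ∨ s = -1) ∧
      ∀ x ∈ band B b, lam - η - δ ≤ s * (g (Fin.cons τ x) - e) ∧
        s * (g (Fin.cons τ x) - e) ≤ lam := by
    rcases le_total 0 (g (Fin.cons τ x₀) - e) with h0 | h0
    · rw [abs_of_nonneg h0] at hx₀'
      refine ⟨1, Or.inl rfl, fun x hx => ?_⟩
      have h1 := abs_le.mp (H.var τ x₀ hx₀ x hx)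
      have h2 := abs_le.mp (hle x hx)
      constructor <;> linarith
    · rw [abs_of_nonpos h0] at hx₀'
      refine ⟨-1, Or.inr rfl, fun x hx => ?_⟩
      have h1 := abs_le.mp (H.var τ x₀ hx₀ x hx)
      have h2 := abs_le.mp (hle x hx)
      constructor <;> linarith
  obtain ⟨s, hs, hsb⟩ := hside
  have hsign : Real.sign (g (Fin.cons τ (bandCorner B b)) - e) = s := by
    have h1 := (hsb _ hcorner).1
    rcases hs with rfl | rfl
    · exact Real.sign_of_pos (by linarith)
    · exact Real.sign_of_neg (by linarith)
  rw [hsign]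
  refine ⟨hgap, hlt, hs, hFτ', fun t ht => ?_, fun x hx => ?_⟩
  · simp only at ht ⊢
    rw [hres t (hτle.trans ht), Set.indicator_of_mem (Set.mem_Ici.mpr ht)]
    simp
  · have h1 := hsb x hx
    simp only
    rw [abs_le]
    rcases hs with rfl | rfl <;> constructor <;> linarith

theorem exists_settled (H : FoldRegular lam h B g b K δ) (r : ℕ)
    (hr : ∀ i < r, ¬FoldsEnd lam h B g b i) :
    ∃ e, Settled lam h B g b (foldState lam h B g b r) e := by
  induction r with
  | zero => exact ⟨_, H.settled_zero⟩
  | succ r ih =>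
    obtain ⟨e, he⟩ := ih fun i hi => hr i (by omega)
    exact ⟨_, (H.settled_step he (hr r (by omega))).2.2.2.2⟩

/-- The number of folds is finite: the folding times increase by steps bounded from below, and
there is no fold where the decaying input cannot move by `h` any more. -/
theorem exists_foldsEnd (H : FoldRegular lam h B g b K δ) : ∃ R, FoldsEnd lam h B g b R := by
  by_contra! hcon
  have := H.nonempty_band
  have hh := H.h_pos
  have hs := fun r => H.exists_settled r fun i _ => hcon i
  choose e he using hs
  have hstep := fun r => H.settled_step (he r) (hcon r)
  have hK0 := H.lip_nonneg
  have hgrow : ∀ r : ℕ, r * h ≤ K * (foldState lam h B g b r).time := by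
    intro r
    induction r with
    | zero => simp [foldState]
    | succ r ih =>
      have := (hstep r).1
      push_cast
      linarith
  obtain ⟨X, hX⟩ := H.decay (h / 4) (by linarith)
  obtain ⟨r, hr⟩ := exists_nat_gt (K * X / h)
  rw [div_lt_iff₀ hh] at hr
  have h1 : X < (foldState lam h B g b r).time := by
    by_contra! h2
    have := mul_le_mul_of_nonneg_left h2 hK0
    linarith [hgrow r]
  have h2 := (hstep r).2.2.2.1
  have h3 : (⨆ x : band B b, |g (Fin.cons (foldState lam h B g b (r + 1)).time x.1) - e r|) ≤
      lam - h / 2 := by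
    refine ciSup_le fun x => ?_
    have h4 := (he r).2 x.1 x.2
    have h5 := abs_le.mp (hX _ h1 x.1 x.2).le
    have h6 := abs_le.mp (hX _ (h1.trans (hstep r).2.1) x.1 x.2).le
    rw [abs_le] at h4 ⊢
    constructor <;> linarith
  linarith

theorem not_foldsEnd_of_lt {i : ℕ} (hi : i < foldCount lam h B g b) : ¬FoldsEnd lam h B g b i :=
  fun h => Nat.notMem_of_lt_sInf hi h

theorem sgn_succ (H : FoldRegular lam h B g b K δ) {r : ℕ} (hr : r < foldCount lam h B g b) :
    (foldState lam h B g b (r + 1)).sgn = 1 ∨ (foldState lam h B g b (r + 1)).sgn = -1 := by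
  obtain ⟨e, he⟩ := H.exists_settled r fun i hi => not_foldsEnd_of_lt (hi.trans hr)
  exact (H.settled_step he (not_foldsEnd_of_lt hr)).2.2.1

theorem add_lt_time_succ (H : FoldRegular lam h B g b K δ) {G : ℝ} (hG : G * K < h) {r : ℕ}
    (hr : r < foldCount lam h B g b) :
    (foldState lam h B g b r).time + G < (foldState lam h B g b (r + 1)).time := by
  obtain ⟨e, he⟩ := H.exists_settled r fun i hi => not_foldsEnd_of_lt (hi.trans hr)
  have h1 := (H.settled_step he (not_foldsEnd_of_lt hr)).1
  by_contra! h2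
  have h3 := mul_le_mul_of_nonneg_left (sub_le_iff_le_add'.mpr h2) H.lip_nonneg
  linarith

end FoldRegular

theorem foldResidual_eq {n : ℕ} (lam h B : ℝ) (g : (Fin (n + 1) → ℝ) → ℝ) (b : Fin n → ℤ)
    (t : ℝ) : foldResidual lam h B g b t = h * ((bandConst lam h B g b : ℝ) +
      ∑ r ∈ Finset.range (foldCount lam h B g b), (foldState lam h B g b (r + 1)).sgn *
        if (foldState lam h B g b (r + 1)).time ≤ t then 1 else 0) := by
  rw [foldResidual, Finset.sum_range_succ']
  simp [foldState, Set.indicator_apply]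

/-! ### Folding a function of Bernstein class -/

namespace BernsteinClass

variable {n : ℕ} {Ω : Fin (n + 1) → ℝ} {M : ℝ} {g : (Fin (n + 1) → ℝ) → ℝ}

theorem bound_nonneg (hg : BernsteinClass Ω M g) : 0 ≤ M := by
  have h := (abs_nonneg _).trans (hg.abs_fwdDiff_le 0 0 0 0 0)
  simpa using h

theorem reflect (hg : BernsteinClass Ω M g) :
    BernsteinClass Ω M fun x => g (ModuloHysteresis.reflect x) := by
  have h0 : ∀ (x : Fin (n + 1) → ℝ) t, ModuloHysteresis.reflect (Function.update x 0 t) =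
      Function.update (ModuloHysteresis.reflect x) 0 (-t) := by
    intro x t
    rw [ModuloHysteresis.reflect, ModuloHysteresis.reflect, Fin.update_cons_zero,
      Function.update_self, Fin.tail_update_zero]
  have h1 : ∀ (x : Fin (n + 1) → ℝ) (d : Fin n) t,
      ModuloHysteresis.reflect (Function.update x d.succ t) =
      Function.update (ModuloHysteresis.reflect x) d.succ t := by
    intro x d t
    rw [ModuloHysteresis.reflect, ModuloHysteresis.reflect, ← Fin.cons_update,
      Function.update_of_ne (Fin.succ_ne_zero d).symm, Fin.tail_update_succ]
  refine ⟨fun d x s t => ?_, fun d x τ N t => ?_, ?_⟩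
  · induction d using Fin.cases with
    | zero =>
      simp only [h0]
      convert hg.abs_sub_le 0 (ModuloHysteresis.reflect x) (-s) (-t) using 2
      rw [neg_sub_neg, abs_sub_comm]
    | succ d =>
      simp only [h1]
      exact hg.abs_sub_le d.succ (ModuloHysteresis.reflect x) s t
  · induction d using Fin.cases with
    | zero =>
      simp only [h0]
      have hflip : ∀ (u : ℝ → ℝ) (t : ℝ),
          (fwdDiff τ)^[N] (fun s => u (-s)) t = (fwdDiff (-τ))^[N] u (-t) := by
        induction N with
        | zero => intro u t; rfl
        | succ N ih =>
          intro u t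
          have e : fwdDiff τ (fun s => u (-s)) = fun s => fwdDiff (-τ) u (-s) := by
            funext s
            simp only [fwdDiff, neg_add]
          rw [Function.iterate_succ_apply, Function.iterate_succ_apply, ← ih, e]
      rw [hflip fun s => g (Function.update (ModuloHysteresis.reflect x) 0 s), ← abs_neg τ]
      exact hg.abs_fwdDiff_le 0 (ModuloHysteresis.reflect x) (-τ) N (-t)
    | succ d =>
      simp only [h1]
      exact hg.abs_fwdDiff_le d.succ (ModuloHysteresis.reflect x) τ N t
  · refine hg.tendsto_zero.comp ?_
    have hcont : Continuous (ModuloHysteresis.reflect : (Fin (n + 1) → ℝ) → _) := by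
      refine continuous_pi fun i => ?_
      refine Fin.cases ?_ (fun d => ?_) i
      · simp only [ModuloHysteresis.reflect, Fin.cons_zero]
        fun_prop
      · simp only [ModuloHysteresis.reflect, Fin.cons_succ, Fin.tail]
        fun_prop
    refine Filter.Tendsto.mono_right (Filter.tendsto_comap_iff.mpr ?_)
      (Filter.comap_cocompact_le hcont)
    have : (ModuloHysteresis.reflect : (Fin (n + 1) → ℝ) → _) ∘ ModuloHysteresis.reflect = id := by
      funext x
      simp [ModuloHysteresis.reflect]
    rw [this]
    exact Filter.tendsto_id

/-- Changing the coordinates one after the other. -/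
theorem abs_sub_le_sum (hg : BernsteinClass Ω M g) (x x' : Fin (n + 1) → ℝ) :
    |g x - g x'| ≤ ∑ d, Ω d * M * |x d - x' d| := by
  classical
  have key : ∀ s : Finset (Fin (n + 1)),
      |g (s.piecewise x x') - g x'| ≤ ∑ d ∈ s, Ω d * M * |x d - x' d| := by
    intro s
    induction s using Finset.induction_on with
    | empty => simp
    | insert d s hd ih =>
      rw [Finset.sum_insert hd, Finset.piecewise_insert]
      have h1 := hg.abs_sub_le d (s.piecewise x x') (x' d) (x d)
      have h2 : Function.update (s.piecewise x x') d (x' d) = s.piecewise x x' := by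
        rw [Function.update_eq_self_iff, Finset.piecewise_eq_of_notMem _ _ _ hd]
      rw [h2] at h1
      exact (_root_.abs_sub_le _ (g (s.piecewise x x')) _).trans (add_le_add h1 ih)
  simpa using key Finset.univ

theorem sum_bandwidth_le {n : ℕ} (Ω : Fin (n + 1) → ℝ) (h0 : 0 ≤ Ω 0) :
    ∑ d : Fin n, Ω d.succ ≤ √((n + 1 : ℕ) : ℝ) * √(∑ d, Ω d ^ 2) := by
  have h1 : (∑ d, Ω d) ^ 2 ≤ ((n + 1 : ℕ) : ℝ) * ∑ d, Ω d ^ 2 := by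
    simpa using sq_sum_le_card_mul_sum_sq (s := Finset.univ) (f := Ω)
  rw [← Real.sqrt_mul (Nat.cast_nonneg _)]
  refine le_trans ?_ (Real.le_sqrt_of_sq_le h1)
  rw [Fin.sum_univ_succ]
  linarith

/-- The variation of the input over a shift of at most `B` in each of the last coordinates. -/
theorem abs_cons_sub_cons_le (hg : BernsteinClass Ω M g) (hΩ : ∀ d, 0 < Ω d) {B : ℝ}
    (t : ℝ) (x x' : Fin n → ℝ) (hx : ∀ d, |x d - x' d| ≤ B) :
    |g (Fin.cons t x) - g (Fin.cons t x')| ≤ M * B * ∑ d : Fin n, Ω d.succ := by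
  refine (hg.abs_sub_le_sum _ _).trans ?_
  rw [Fin.sum_univ_succ, Finset.mul_sum]
  simp only [Fin.cons_zero, Fin.cons_succ, sub_self, abs_zero, mul_zero, zero_add]
  refine Finset.sum_le_sum fun d _ => ?_
  have h1 : 0 ≤ Ω d.succ * M := mul_nonneg (hΩ _).le hg.bound_nonneg
  nlinarith [mul_le_mul_of_nonneg_left (hx d) h1]

theorem foldRegular (hg : BernsteinClass Ω M g) (hΩ : ∀ d, 0 < Ω d) {lam h B : ℝ} (hB : 0 < B)
    (h1 : M * B * ∑ d : Fin n, Ω d.succ < min (h / 2) (2 * lam - 3 * h)) (b : Fin n → ℤ) :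
    FoldRegular lam h B g b (Ω 0 * M) (M * B * ∑ d : Fin n, Ω d.succ) := by
  have hM := hg.bound_nonneg
  have hS : 0 ≤ ∑ d : Fin n, Ω d.succ := Finset.sum_nonneg fun d _ => (hΩ _).le
  obtain ⟨ha, hb⟩ := lt_min_iff.mp h1
  refine ⟨hB, ?_, fun x _ s t => ?_, fun t x hx x' hx' => ?_, ha, hb, fun η hη => ?_⟩
  · have : 0 ≤ M * B * ∑ d : Fin n, Ω d.succ := by positivity
    linarith
  · have h2 := hg.abs_sub_le 0 (Fin.cons 0 x) s t
    rwa [Fin.update_cons_zero, Fin.update_cons_zero] at h2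
  · refine hg.abs_cons_sub_cons_le hΩ t x x' fun d => ?_
    have h2 := hx d
    have h3 := hx' d
    rw [abs_le]
    constructor <;> linarith
  · have h2 : ∀ᶠ x in Filter.cocompact (Fin (n + 1) → ℝ), |g x| < η := by
      simpa using hg.tendsto_zero.eventually (Metric.ball_mem_nhds 0 hη)
    obtain ⟨R, -, hR⟩ :=
      (Metric.hasBasis_cobounded_compl_closedBall (0 : Fin (n + 1) → ℝ)).mem_iff.mp
        (by rwa [Metric.cobounded_eq_cocompact])
    refine ⟨R, fun t ht x _ => hR ?_⟩
    rw [Set.mem_compl_iff, mem_closedBall_zero_iff, not_le]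
    have h3 := norm_le_pi_norm (Fin.cons t x : Fin (n + 1) → ℝ) 0
    rw [Fin.cons_zero, Real.norm_eq_abs] at h3
    exact ht.trans_le ((le_abs_self t).trans h3)

/-- The constants of neighbouring bands differ by at most one, because a shift by one band changes
the input by less than `h`. -/
theorem abs_bandConst_sub_le (hg : BernsteinClass Ω M g) (hΩ : ∀ d, 0 < Ω d) {lam h B : ℝ}
    (hB : 0 < B) (h1 : M * B * ∑ d : Fin n, Ω d.succ < min (h / 2) (2 * lam - 3 * h))
    (b : Fin n → ℤ) (d : Fin n) :
    |bandConst lam h B g (nextBand b d) - bandConst lam h B g b| ≤ 1 := by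
  have H := fun b => hg.foldRegular hΩ hB h1 b
  have hh := (H 0).h_pos
  have hhalf := (H 0).lt_half
  have hne := fun b => (H b).nonempty_band
  have hbdd : ∀ b, BddBelow (Set.range fun x : band B b => g (Fin.cons 0 x.1)) := by
    intro b
    refine ⟨g (Fin.cons 0 (bandCorner B b)) - M * B * ∑ d : Fin n, Ω d.succ, ?_⟩
    rintro _ ⟨x', rfl⟩
    have h1 := abs_le.mp ((H b).var 0 _ (bandCorner_mem_band hB b) x'.1 x'.2)
    simp only
    linarith
  have hshift : ∀ (x : Fin n → ℝ) (c : ℝ), |c| = B →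
      |g (Fin.cons 0 x) - g (Fin.cons 0 (Function.update x d (x d + c)))| < h := by
    intro x c hc
    refine (hg.abs_cons_sub_cons_le hΩ 0 _ _ (B := B) fun i => ?_).trans_lt (by linarith)
    by_cases hi : i = d
    · subst hi
      simp [hc]
    · simp [hi, hB.le]
  have hmem : ∀ x : Fin n → ℝ, x ∈ band B b ↔
      Function.update x d (x d + B) ∈ band B (nextBand b d) := by
    intro x
    refine forall_congr' fun i => ?_
    by_cases hi : i = d
    · subst hi
      simp only [nextBand, Function.update_self]
      push_cast
      constructor <;> rintro ⟨h1, h2⟩ <;> constructor <;> linarith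
    · simp [nextBand, hi]
  set a := ⨅ x : band B b, g (Fin.cons 0 x.1) with ha
  set a' := ⨅ x : band B (nextBand b d), g (Fin.cons 0 x.1) with ha'
  have hle1 : a' ≤ a + h := by
    rw [← sub_le_iff_le_add]
    have := hne b
    refine le_ciInf fun x => ?_
    have h2 := ciInf_le (hbdd (nextBand b d)) ⟨_, (hmem x.1).mp x.2⟩
    have h3 := abs_lt.mp (hshift x.1 B (abs_of_pos hB))
    simp only at h2
    linarith
  have hle2 : a ≤ a' + h := by
    rw [← sub_le_iff_le_add]
    have := hne (nextBand b d)
    refine le_ciInf fun x => ?_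
    have hx : Function.update x.1 d (x.1 d + -B) ∈ band B b := by
      rw [hmem]
      simp [x.2]
    have h2 := ciInf_le (hbdd b) ⟨_, hx⟩
    have h3 := abs_lt.mp (hshift x.1 (-B) (by rw [abs_neg, abs_of_pos hB]))
    simp only at h2
    linarith
  rw [bandConst, bandConst, ← ha, ← ha']
  have hf : ∀ u v : ℝ, u ≤ v + h → ⌊(u + lam) / h⌋ ≤ ⌊(v + lam) / h⌋ + 1 := by
    intro u v huv
    rw [← Int.floor_add_one]
    refine Int.floor_le_floor ?_
    rw [div_add_one hh.ne']
    exact div_le_div_of_nonneg_right (by linarith) hh.le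
  have h2 := hf _ _ hle1
  have h3 := hf _ _ hle2
  rw [abs_le]
  constructor <;> linarith

end BernsteinClass

/-! ### Finite differences and the filters -/

theorem diffCoeff_succ (N : ℕ) (j : ℤ) :
    diffCoeff (N + 1) j = diffCoeff N (j - 1) - diffCoeff N j := by
  rw [diffCoeff, diffCoeff, diffCoeff, diffMinus, neg_sub, neg_add_eq_sub]

theorem diffCoeff_eq_zero (N : ℕ) {j : ℤ} (hj : j < 0 ∨ (N : ℤ) < j) : diffCoeff N j = 0 := by
  induction N generalizing j with
  | zero =>
    rw [diffCoeff, diffMinus, if_neg]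
    push_cast at hj
    omega
  | succ N ih =>
    push_cast at hj
    rw [diffCoeff_succ, ih (by omega), ih (by omega), sub_zero]

theorem hasSum_mul_diffCoeff (N : ℕ) (u : ℤ → ℝ) (m : ℤ) :
    HasSum (fun j => u j * diffCoeff N (j - m)) ((fwdDiff 1)^[N] u m) := by
  induction N generalizing m with
  | zero =>
    convert! hasSum_ite_eq m (u m) using 2 with j
    rw [diffCoeff, diffMinus]
    by_cases hj : j = m
    · simp [hj]
    · rw [if_neg (by omega), if_neg hj, mul_zero]
  | succ N ih =>
    rw [Function.iterate_succ_apply']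
    convert! (ih (m + 1)).sub (ih m) using 2 with j
    rw [diffCoeff_succ, mul_sub, sub_sub]

/-- The unit step at `q` on the integers. -/
def unitStep (q : ℤ) (j : ℤ) : ℝ := if q ≤ j then 1 else 0

theorem fwdDiff_iter_unitStep_of_lt (N : ℕ) {q m : ℤ} (h : m + N < q) :
    (fwdDiff 1)^[N] (unitStep q) m = 0 := by
  induction N generalizing m with
  | zero => simpa [unitStep] using h
  | succ N ih =>
    push_cast at h
    rw [Function.iterate_succ_apply', fwdDiff, ih (by omega), ih (by omega), sub_zero]

theorem fwdDiff_iter_unitStep_of_le (N : ℕ) {q m : ℤ} (h : q ≤ m) :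
    (fwdDiff 1)^[N + 1] (unitStep q) m = 0 := by
  induction N generalizing m with
  | zero => simp [unitStep, fwdDiff, h, h.trans (Int.le_add_one le_rfl)]
  | succ N ih =>
    rw [Function.iterate_succ_apply', fwdDiff, ih (by omega), ih (by omega), sub_zero]

/-- The first index at which the difference of order `N` sees a step, it sees it with weight `1`. -/
theorem fwdDiff_iter_unitStep_of_eq (N : ℕ) {q m : ℤ} (h : m + N = q) :
    (fwdDiff 1)^[N] (unitStep q) m = 1 := by
  induction N generalizing m with
  | zero => simp [unitStep, ← h]
  | succ N ih =>
    push_cast at h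
    rw [Function.iterate_succ_apply', fwdDiff, ih (by omega),
      fwdDiff_iter_unitStep_of_lt N (by omega), sub_zero]

theorem fwdDiff_iter_unitStep_pred (N : ℕ) (m : ℤ) :
    (fwdDiff 1)^[N + 1] (unitStep (m + 1)) m = (-1) ^ N := by
  induction N with
  | zero => simp [unitStep, fwdDiff]
  | succ N ih =>
    rw [Function.iterate_succ_apply', fwdDiff, ih, fwdDiff_iter_unitStep_of_le N le_rfl, pow_succ]
    ring

theorem fwdDiff_iter_congr {u v : ℤ → ℝ} (N : ℕ) (m : ℤ)
    (h : ∀ j, m ≤ j → j ≤ m + N → u j = v j) :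
    (fwdDiff 1)^[N] u m = (fwdDiff 1)^[N] v m := by
  induction N generalizing m with
  | zero => simpa using h m le_rfl (by simp)
  | succ N ih =>
    rw [Function.iterate_succ_apply', Function.iterate_succ_apply', fwdDiff, fwdDiff,
      ih (m + 1) fun j h1 h2 => h j (by omega) (by push_cast; omega),
      ih m fun j h1 h2 => h j (by omega) (by push_cast; omega)]

theorem fwdDiff_iter_comp_mul (N : ℕ) (τ : ℝ) (u : ℝ → ℝ) (m : ℤ) :
    (fwdDiff (1 : ℤ))^[N] (fun j : ℤ => u (τ * j)) m = (fwdDiff τ)^[N] u (τ * m) := by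
  induction N generalizing m with
  | zero => rfl
  | succ N ih =>
    rw [Function.iterate_succ_apply', Function.iterate_succ_apply', fwdDiff, fwdDiff, ih, ih]
    push_cast
    rw [mul_add, mul_one]

theorem fwdDiff_iter_sub (N : ℕ) (u v : ℤ → ℝ) (m : ℤ) :
    (fwdDiff 1)^[N] (fun j => u j - v j) m = (fwdDiff 1)^[N] u m - (fwdDiff 1)^[N] v m := by
  induction N generalizing m with
  | zero => rfl
  | succ N ih =>
    simp only [Function.iterate_succ_apply', fwdDiff, ih]
    ring

theorem fwdDiff_iter_const (N : ℕ) (a : ℝ) (m : ℤ) :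
    (fwdDiff 1)^[N + 1] (fun _ : ℤ => a) m = 0 := by
  induction N generalizing m with
  | zero => simp [fwdDiff]
  | succ N ih => rw [Function.iterate_succ_apply', fwdDiff, ih, ih, sub_zero]

/-- A filter which takes differences in direction `i`, and sums over a finite set `P` of lines in
that direction; each line is represented by its point with `i`-th coordinate zero. -/
theorem seqInner_eq_sum_fwdDiff {n : ℕ} (i : Fin (n + 1)) (P : Finset (Fin (n + 1) → ℤ))
    (hP : ∀ p ∈ P, p i = 0) (N : ℕ) (m : ℤ) (C : ℝ) (y ψ : (Fin (n + 1) → ℤ) → ℝ)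
    (hψ : ∀ k, ψ k = if Function.update k i 0 ∈ P then diffCoeff N (k i - m) / C else 0) :
    seqInner y ψ = (∑ p ∈ P, (fwdDiff 1)^[N] (fun j => y (Function.update p i j)) m) / C := by
  classical
  have hline : ∀ p ∈ P, HasSum
      (fun k => if Function.update k i 0 = p then y k * diffCoeff N (k i - m) else 0)
      ((fwdDiff 1)^[N] (fun j => y (Function.update p i j)) m) := by
    intro p hp
    have hinj : Function.Injective fun j : ℤ => Function.update p i j :=
      Function.update_injective p i
    rw [← hinj.hasSum_iff]
    · convert! hasSum_mul_diffCoeff N (fun j => y (Function.update p i j)) m using 2 with j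
      have : Function.update p i 0 = p := by rw [← hP p hp, Function.update_eq_self]
      simp [this]
    · intro k hk
      rw [if_neg]
      rintro rfl
      exact hk ⟨k i, by simp⟩
  have hsum := (hasSum_sum hline).div_const C
  rw [seqInner, ← hsum.tsum_eq]
  refine tsum_congr fun k => ?_
  rw [Finset.sum_ite_eq, hψ]
  split_ifs
  · rw [mul_div_assoc]
  · simp

/-- An average of quantities within `β` of `κ` is within `β` of `κ`. -/
theorem exists_average_eq_add {ι : Type*} (P : Finset ι) {C : ℝ} (hC : (P.card : ℝ) = C)
    (hC0 : 0 < C) (z : ι → ℝ) {κ β : ℝ} (hz : ∀ p ∈ P, |z p - κ| ≤ β) :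
    ∃ w, |w| ≤ β ∧ (∑ p ∈ P, z p) / C = w + κ := by
  refine ⟨(∑ p ∈ P, (z p - κ)) / C, ?_, ?_⟩
  · rw [abs_div, abs_of_pos hC0, div_le_iff₀ hC0]
    calc |∑ p ∈ P, (z p - κ)| ≤ ∑ p ∈ P, |z p - κ| := Finset.abs_sum_le_sum_abs _ _
      _ ≤ ∑ _p ∈ P, β := Finset.sum_le_sum hz
      _ = β * C := by rw [Finset.sum_const, nsmul_eq_mul, hC, mul_comm]
  · rw [Finset.sum_sub_distrib, Finset.sum_const, nsmul_eq_mul, hC]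
    field_simp
    ring

/-! ### Detection of well separated steps -/

section Detection

variable {n N R : ℕ} {h B : ℝ} {T : Fin (n + 1) → ℝ} {NB : Fin n → ℕ}
  {y : (Fin (n + 1) → ℤ) → ℝ} {b : Fin n → ℤ} {q : ℕ → ℕ} {s : ℕ → ℝ}

/-- The filtered data of band `b` are, up to an error below `h / 2`, the negated differences of
order `N` of a sum of `R` steps of heights `± h` at the indices `q 0, q 1, …`, and these indices are
more than `N` apart. -/
structure StepData {n : ℕ} (h B : ℝ) (T : Fin (n + 1) → ℝ) (NB : Fin n → ℕ) (N : ℕ)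
    (y : (Fin (n + 1) → ℤ) → ℝ) (b : Fin n → ℤ) (R : ℕ) (q : ℕ → ℕ) (s : ℕ → ℝ) : Prop where
  h_pos : 0 < h
  N_pos : 1 ≤ N
  sign : ∀ r < R, s r = 1 ∨ s r = -1
  lt_zero : 0 < R → N < q 0
  lt_succ : ∀ r, r + 1 < R → q r + N < q (r + 1)
  data : ∀ m : ℕ, 0 < m → ∃ w, |w| < h / 2 ∧ seqInner y (foldFilter T B NB N b m) =
    w - h * ∑ r ∈ Finset.range R, s r * (fwdDiff 1)^[N] (unitStep (q r)) m

namespace StepData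

theorem add_lt (H : StepData h B T NB N y b R q s) {i j : ℕ} (hij : i < j) (hj : j < R) :
    q i + N < q j := by
  induction j with
  | zero => omega
  | succ j ih =>
    have h1 := H.lt_succ j hj
    rcases Nat.lt_succ_iff_lt_or_eq.mp hij with h2 | rfl
    · have := ih h2 (by omega)
      omega
    · exact h1

theorem lt (H : StepData h B T NB N y b R q s) {r : ℕ} (hr : r < R) : N < q r := by
  rcases Nat.eq_zero_or_pos r with rfl | h0
  · exact H.lt_zero hr
  · have := H.add_lt h0 hr
    omega

theorem fwdDiff_unitStep_eq_zero (H : StepData h B T NB N y b R q s) {i m : ℕ}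
    (hi : q i ≤ m ∨ m + N < q i) : (fwdDiff 1)^[N] (unitStep (q i)) (m : ℤ) = 0 := by
  obtain ⟨N', rfl⟩ := Nat.exists_eq_add_of_le' H.N_pos
  rcases hi with h1 | h1
  · exact fwdDiff_iter_unitStep_of_le N' (by exact_mod_cast h1)
  · exact fwdDiff_iter_unitStep_of_lt _ (by exact_mod_cast h1)

theorem not_large (H : StepData h B T NB N y b R q s) {m : ℕ} (hm : 0 < m)
    (hq : ∀ i < R, q i ≤ m ∨ m + N < q i) :
    ¬h / 2 ≤ |seqInner y (foldFilter T B NB N b m)| := by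
  obtain ⟨w, hw, he⟩ := H.data m hm
  have h0 : ∑ r ∈ Finset.range R, s r * (fwdDiff 1)^[N] (unitStep (q r)) (m : ℤ) = 0 :=
    Finset.sum_eq_zero fun i hi => by
      rw [H.fwdDiff_unitStep_eq_zero (hq i (Finset.mem_range.mp hi)), mul_zero]
  rw [he, h0, mul_zero, sub_zero]
  exact not_le.mpr hw

/-- The window which just reaches a step sees the full height of this step, and no other step. -/
theorem seqInner_eq (H : StepData h B T NB N y b R q s) {r : ℕ} (hr : r < R) :
    ∃ w, |w| < h / 2 ∧ seqInner y (foldFilter T B NB N b ((q r - N : ℕ) : ℤ)) = w - h * s r := by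
  have hlt := H.lt hr
  obtain ⟨w, hw, he⟩ := H.data (q r - N) (by omega)
  refine ⟨w, hw, ?_⟩
  rw [he, Finset.sum_eq_single r, fwdDiff_iter_unitStep_of_eq N (by omega), mul_one]
  · intro i hi hir
    rw [H.fwdDiff_unitStep_eq_zero, mul_zero]
    rcases Nat.lt_or_gt_of_ne hir with h1 | h1
    · have := H.add_lt h1 hr
      omega
    · have := H.add_lt h1 (Finset.mem_range.mp hi)
      omega
  · intro h1
    exact absurd (Finset.mem_range.mpr hr) h1

theorem large (H : StepData h B T NB N y b R q s) {r : ℕ} (hr : r < R) :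
    h / 2 ≤ |seqInner y (foldFilter T B NB N b ((q r - N : ℕ) : ℤ))| := by
  obtain ⟨w, hw, he⟩ := H.seqInner_eq hr
  obtain ⟨h1, h2⟩ := abs_lt.mp hw
  rw [he, le_abs]
  rcases H.sign r hr with hs | hs <;> rw [hs]
  · right; linarith
  · left; linarith

theorem neg_sign_eq (H : StepData h B T NB N y b R q s) {r : ℕ} (hr : r < R) :
    -Real.sign (seqInner y (foldFilter T B NB N b ((q r - N : ℕ) : ℤ))) = s r := by
  obtain ⟨w, hw, he⟩ := H.seqInner_eq hr
  obtain ⟨h1, h2⟩ := abs_lt.mp hw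
  have hh := H.h_pos
  rw [he]
  rcases H.sign r hr with hs | hs <;> rw [hs]
  · rw [Real.sign_of_neg (by linarith), neg_neg]
  · rw [Real.sign_of_pos (by linarith)]

/-- The search for the next detection beyond `L`, when the steps already passed are those with
index less than `r`. -/
theorem sInf_eq (H : StepData h B T NB N y b R q s) {L r : ℕ} (hL : ∀ i < r, q i ≤ L)
    (hLr : r < R → L + N < q r) :
    sInf {i : ℕ∞ | ∃ m : ℕ, i = m ∧ (L : ℕ∞) < m ∧
      h / 2 ≤ |seqInner y (foldFilter T B NB N b m)|} =
      if r < R then ((q r - N : ℕ) : ℕ∞) else ⊤ := by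
  split_ifs with hr
  · have hLr := hLr hr
    refine IsLeast.csInf_eq ⟨⟨_, rfl, ?_, H.large hr⟩, ?_⟩
    · exact_mod_cast (by omega : L < q r - N)
    · rintro _ ⟨m, rfl, hm, hlarge⟩
      rw [Nat.cast_lt] at hm
      rw [Nat.cast_le]
      by_contra! hlt
      refine H.not_large (by omega) (fun i hi => ?_) hlarge
      rcases Nat.lt_trichotomy i r with h1 | rfl | h1
      · have := hL i h1
        omega
      · omega
      · have := H.add_lt h1 hi
        omega
  · convert! sInf_empty
    rw [Set.eq_empty_iff_forall_notMem]
    rintro _ ⟨m, rfl, hm, hlarge⟩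
    rw [Nat.cast_lt] at hm
    refine H.not_large (by omega) (fun i hi => ?_) hlarge
    have := hL i (by omega)
    omega

theorem detection_eq (H : StepData h B T NB N y b R q s) (r : ℕ) :
    detection h B T NB N y b r = if r < R then ((q r - N : ℕ) : ℕ∞) else ⊤ := by
  induction r with
  | zero =>
    rw [detection, ← H.sInf_eq (L := 0) (by simp) fun hR => by simpa using H.lt_zero hR]
    simp
  | succ r ih =>
    rw [detection, ih]
    by_cases hr : r < R
    · have hcast : ((q r - N : ℕ) : ℕ∞) + (N : ℕ∞) = (q r : ℕ∞) := by
        exact_mod_cast Nat.sub_add_cancel (H.lt hr).le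
      rw [if_pos hr, hcast]
      refine H.sInf_eq (fun i hi => ?_) (H.lt_succ r)
      rcases Nat.lt_succ_iff_lt_or_eq.mp hi with h1 | rfl
      · have := H.add_lt h1 hr
        omega
      · exact le_rfl
    · rw [if_neg hr, if_neg (by omega)]
      simp

theorem foldSumEst_eq (H : StepData h B T NB N y b R q s) (k : ℕ) :
    foldSumEst h B T NB N y b k =
      ∑ r ∈ Finset.range R, s r * if q r ≤ k then 1 else 0 := by
  rw [foldSumEst, finsum_eq_sum_of_support_subset (s := Finset.range R)]
  · refine Finset.sum_congr rfl fun r hr => ?_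
    rw [Finset.mem_range] at hr
    have hlt := H.lt hr
    have hcond : detection h B T NB N y b r + (N : ℕ∞) ≤ (k : ℕ∞) ↔ q r ≤ k := by
      rw [H.detection_eq, if_pos hr, ← Nat.cast_add, Nat.sub_add_cancel hlt.le, Nat.cast_le]
    simp only [hcond]
    split_ifs
    · rw [H.detection_eq, if_pos hr, ENat.toNat_natCast, H.neg_sign_eq hr, mul_one]
    · rw [mul_zero]
  · intro r hr
    by_contra hr'
    rw [Finset.mem_coe, Finset.mem_range] at hr'
    refine hr ?_
    simp [H.detection_eq, hr']

end StepData

end Detection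

/-! ### The filtered samples of a folded function -/

section Samples

variable {n N : ℕ} {Ω T : Fin (n + 1) → ℝ} {M lam h B : ℝ} {NB : Fin n → ℕ}
  {g : (Fin (n + 1) → ℝ) → ℝ} {y : (Fin (n + 1) → ℤ) → ℝ}

/-- The lattice coordinates `T k` of the sample with index `k`. -/
def sampleCoord (T : Fin (n + 1) → ℝ) (k : Fin (n + 1) → ℤ) : Fin (n + 1) → ℝ :=
  fun d => T d * k d

theorem sampleCoord_update (k : Fin (n + 1) → ℤ) (i : Fin (n + 1)) (j : ℤ) :
    sampleCoord T (Function.update k i j) = Function.update (sampleCoord T k) i (T i * j) := by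
  funext d
  by_cases hd : d = i
  · subst hd; simp [sampleCoord]
  · simp [sampleCoord, hd]

theorem bandIndex_eq (hB : 0 < B) {x : Fin n → ℝ} {b : Fin n → ℤ} (hx : x ∈ band B b) :
    bandIndex B x = b := by
  funext d
  rw [bandIndex, Int.floor_eq_iff, le_div_iff₀ hB, div_lt_iff₀ hB]
  exact hx d

theorem mem_band_bandIndex (hB : 0 < B) (x : Fin n → ℝ) : x ∈ band B (bandIndex B x) := by
  intro d
  rw [← le_div_iff₀ hB, ← div_lt_iff₀ hB]
  exact ⟨Int.floor_le _, Int.lt_floor_add_one _⟩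

theorem sampleTail_mem_band (hT : ∀ d, 0 < T d) (hNB : ∀ d, B / T d.succ = (NB d : ℝ))
    (k : Fin (n + 1) → ℤ) (b : Fin n → ℤ) :
    sampleTail T k ∈ band B b ↔ ∀ d, k d.succ ∈ Finset.Ico (b d * NB d) ((b d + 1) * NB d) := by
  refine forall_congr' fun d => ?_
  have hTd := hT d.succ
  have hBd : B = NB d * T d.succ := by rw [← hNB d, div_mul_cancel₀ _ hTd.ne']
  rw [Finset.mem_Ico, sampleTail, hBd, mul_comm (T d.succ), ← mul_assoc, ← mul_assoc,
    mul_le_mul_iff_left₀ hTd, mul_lt_mul_iff_left₀ hTd]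
  norm_cast

/-- Bernstein's inequality for the samples along a line of the lattice. -/
theorem BernsteinClass.abs_fwdDiff_sample_le (hg : BernsteinClass Ω M g) (hT : ∀ d, 0 < T d)
    (N : ℕ) (p : Fin (n + 1) → ℤ) (i : Fin (n + 1)) (m : ℤ) :
    |(fwdDiff 1)^[N] (fun j => g (sampleCoord T (Function.update p i j))) m| ≤
      (T i * Ω i) ^ N * M := by
  simp only [sampleCoord_update]
  rw [fwdDiff_iter_comp_mul N (T i) fun t => g (Function.update (sampleCoord T p) i t)]
  have h := hg.abs_fwdDiff_le i (sampleCoord T p) (T i) N (T i * m)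
  rwa [abs_of_pos (hT i)] at h

/-- The indices of the samples in band `b` with `k₁ = 0`: one for each line of the filter
`foldFilter`. -/
def foldLines (NB : Fin n → ℕ) (b : Fin n → ℤ) : Finset (Fin (n + 1) → ℤ) :=
  Fintype.piFinset (Fin.cons {0} fun d => Finset.Ico (b d * NB d) ((b d + 1) * NB d) :
    Fin (n + 1) → Finset ℤ)

theorem mem_foldLines {b : Fin n → ℤ} {p : Fin (n + 1) → ℤ} : p ∈ foldLines NB b ↔
    p 0 = 0 ∧ ∀ d : Fin n, p d.succ ∈ Finset.Ico (b d * NB d) ((b d + 1) * NB d) := by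
  rw [foldLines, Fintype.mem_piFinset, Fin.forall_fin_succ]
  simp

theorem card_foldLines (NB : Fin n → ℕ) (b : Fin n → ℤ) :
    ((foldLines NB b).card : ℝ) = ∏ d, (NB d : ℝ) := by
  rw [foldLines, Fintype.card_piFinset, Fin.prod_univ_succ]
  simp [← sub_mul]

theorem seqInner_foldFilter (hT : ∀ d, 0 < T d) (hNB : ∀ d, B / T d.succ = (NB d : ℝ)) (N : ℕ)
    (y : (Fin (n + 1) → ℤ) → ℝ) (b : Fin n → ℤ) (m : ℤ) :
    seqInner y (foldFilter T B NB N b m) =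
      (∑ p ∈ foldLines NB b, (fwdDiff 1)^[N] (fun j => y (Function.update p 0 j)) m) /
        ∏ d, (NB d : ℝ) := by
  refine seqInner_eq_sum_fwdDiff 0 _ (fun p hp => (mem_foldLines.mp hp).1) N m _ y _ fun k => ?_
  have hiff : sampleTail T k ∈ band B b ↔ Function.update k 0 0 ∈ foldLines NB b := by
    rw [sampleTail_mem_band hT hNB, mem_foldLines]
    simp
  rw [foldFilter]
  by_cases hk : sampleTail T k ∈ band B b
  · rw [if_pos hk, if_pos (hiff.mp hk)]
  · rw [if_neg hk, if_neg (mt hiff.mpr hk)]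

theorem foldHalf_sample (hB : 0 < B) {b : Fin n → ℤ} {k : Fin (n + 1) → ℤ}
    (hk : sampleTail T k ∈ band B b) :
    foldHalf lam h B g (sampleCoord T k) =
      g (sampleCoord T k) - foldResidual lam h B g b (T 0 * k 0) := by
  rw [foldHalf]
  have : Fin.tail (sampleCoord T k) = sampleTail T k := rfl
  rw [this, bandIndex_eq hB hk]
  rfl

/-- The detected folds sum up to the residual. Here `y` is only required to be folded data on the
half-space `k₁ ≥ 0`. -/
theorem BernsteinClass.foldResidual_eq_foldSumEst (hg : BernsteinClass Ω M g)
    (hΩ : ∀ d, 0 < Ω d) (hT : ∀ d, 0 < T d) (hB : 0 < B)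
    (hNB : ∀ d, B / T d.succ = (NB d : ℝ)) (hNB0 : ∀ d, 0 < NB d) (hN : 1 ≤ N)
    (h1 : M * B * ∑ d : Fin n, Ω d.succ < min (h / 2) (2 * lam - 3 * h))
    (h2 : (T 0 * Ω 0) ^ N * M < h / 2) (h3 : ((N : ℝ) + 1) * T 0 * (Ω 0 * M) < h)
    (hy : ∀ k, 0 ≤ k 0 → y k = foldHalf lam h B g (sampleCoord T k)) (b : Fin n → ℤ) (k : ℕ) :
    foldResidual lam h B g b (T 0 * (k : ℤ)) =
      h * ((bandConst lam h B g b : ℝ) + foldSumEst h B T NB N y b k) := by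
  have H := hg.foldRegular hΩ hB h1 b
  have hT0 := hT 0
  set R := foldCount lam h B g b with hR
  set τ : ℕ → ℝ := fun r => (foldState lam h B g b r).time with hτ
  set s : ℕ → ℝ := fun r => (foldState lam h B g b (r + 1)).sgn with hs
  set q : ℕ → ℕ := fun r => ⌈τ (r + 1) / T 0⌉₊ with hq
  have hgap : ∀ r < R, τ r / T 0 + (N + 1) < τ (r + 1) / T 0 := by
    intro r hr
    have h4 := H.add_lt_time_succ h3 hr
    rw [lt_div_iff₀ hT0, add_mul, div_mul_cancel₀ _ hT0.ne']
    exact h4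
  have hτ0 : τ 0 = 0 := rfl
  have hq0 : 0 < R → N < q 0 := by
    intro hR0
    have h4 := hgap 0 hR0
    rw [hτ0, zero_div, zero_add] at h4
    rw [hq, Nat.lt_ceil]
    linarith
  have hτnn : ∀ r ≤ R, 0 ≤ τ r / T 0 := by
    intro r
    induction r with
    | zero => simp [hτ0]
    | succ r ih =>
      intro hr
      have h4 := hgap r hr
      have h5 := ih (by omega)
      have h6 : (0 : ℝ) ≤ N := N.cast_nonneg
      linarith
  have hqs : ∀ r, r + 1 < R → q r + N < q (r + 1) := by
    intro r hr
    have h4 := hgap (r + 1) hr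
    have h5 := Nat.ceil_lt_add_one (hτnn (r + 1) hr.le)
    rw [hq, Nat.lt_ceil]
    push_cast
    linarith
  have hstep : ∀ r < R, ∀ j : ℤ, τ (r + 1) ≤ T 0 * j ↔ (q r : ℤ) ≤ j := by
    intro r hr j
    rw [hq, Int.natCast_ceil_eq_ceil (hτnn (r + 1) hr), Int.ceil_le, div_le_iff₀ hT0, mul_comm]
  have hres : ∀ j : ℤ, foldResidual lam h B g b (T 0 * j) = h * ((bandConst lam h B g b : ℝ) +
      ∑ r ∈ Finset.range R, s r * unitStep (q r) j) := by
    intro j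
    rw [foldResidual_eq]
    congr 2
    refine Finset.sum_congr rfl fun r hr => ?_
    rw [unitStep, if_congr (hstep r (Finset.mem_range.mp hr) j) rfl rfl]
  have hresd : ∀ m : ℤ, (fwdDiff 1)^[N] (fun j : ℤ => foldResidual lam h B g b (T 0 * j)) m =
      h * ∑ r ∈ Finset.range R, s r * (fwdDiff 1)^[N] (unitStep (q r)) m := by
    intro m
    obtain ⟨N', rfl⟩ := Nat.exists_eq_add_of_le' hN
    have e : (fun j : ℤ => foldResidual lam h B g b (T 0 * j)) =
        h • ((fun _ => (bandConst lam h B g b : ℝ)) +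
          ∑ r ∈ Finset.range R, s r • unitStep (q r)) := by
      funext j
      simp [hres]
    rw [e, fwdDiff_iter_const_smul, fwdDiff_iter_add, fwdDiff_iter_finsetSum, Pi.smul_apply,
      Pi.add_apply, fwdDiff_iter_const, zero_add, Finset.sum_apply, smul_eq_mul]
    simp only [fwdDiff_iter_const_smul, Pi.smul_apply, smul_eq_mul]
  have hC0 : 0 < ∏ d, (NB d : ℝ) := Finset.prod_pos fun d _ => Nat.cast_pos.mpr (hNB0 d)
  have hdata : StepData h B T NB N y b R q s := by
    refine ⟨H.h_pos, hN, fun r hr => H.sgn_succ hr, hq0, hqs, fun m hm => ?_⟩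
    have hline : ∀ p ∈ foldLines NB b,
        |(fwdDiff 1)^[N] (fun j => y (Function.update p 0 j)) (m : ℤ) -
          -(h * ∑ r ∈ Finset.range R, s r * (fwdDiff 1)^[N] (unitStep (q r)) (m : ℤ))| ≤
          (T 0 * Ω 0) ^ N * M := by
      intro p hp
      obtain ⟨-, hp1⟩ := mem_foldLines.mp hp
      have hcongr : (fwdDiff 1)^[N] (fun j => y (Function.update p 0 j)) (m : ℤ) =
          (fwdDiff 1)^[N] (fun j => g (sampleCoord T (Function.update p 0 j)) -
            foldResidual lam h B g b (T 0 * j)) (m : ℤ) := by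
        refine fwdDiff_iter_congr N m fun j hj _ => ?_
        rw [hy _ (by rw [Function.update_self]; omega), foldHalf_sample (b := b) hB,
          Function.update_self]
        rw [sampleTail_mem_band hT hNB]
        simpa using hp1
      rw [hcongr, fwdDiff_iter_sub, hresd, sub_neg_eq_add, sub_add_cancel]
      exact hg.abs_fwdDiff_sample_le hT N p 0 m
    obtain ⟨w, hw, he⟩ := exists_average_eq_add _ (card_foldLines NB b) hC0 _ hline
    refine ⟨w, hw.trans_lt h2, ?_⟩
    rw [seqInner_foldFilter hT hNB, he, sub_eq_add_neg]
  rw [hdata.foldSumEst_eq, hres]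
  simp only [unitStep, Nat.cast_le]

end Samples

/-! ### The constants of the bands -/

section BandConstants

theorem sum_Ico_sub_sum_Ico (F : ℤ → ℝ) (z : ℤ) :
    ∑ j ∈ Finset.Ico 0 z, (F (j + 1) - F j) - ∑ j ∈ Finset.Ico z 0, (F (j + 1) - F j) =
      F z - F 0 := by
  induction z using Int.induction_on with
  | zero => simp
  | succ i ih =>
    have e1 : Finset.Ico (0 : ℤ) (i + 1) = insert (i : ℤ) (Finset.Ico (0 : ℤ) i) := by
      ext j; simp only [Finset.mem_insert, Finset.mem_Ico]; omega
    have e2 : Finset.Ico (i : ℤ) 0 = ∅ := Finset.Ico_eq_empty (by omega)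
    have e3 : Finset.Ico ((i : ℤ) + 1) 0 = ∅ := Finset.Ico_eq_empty (by omega)
    rw [e2, Finset.sum_empty] at ih
    rw [e1, e3, Finset.sum_empty, Finset.sum_insert (by simp)]
    linarith
  | pred i ih =>
    have e1 : Finset.Ico (-(i : ℤ) - 1) 0 = insert (-(i : ℤ) - 1) (Finset.Ico (-(i : ℤ)) 0) := by
      ext j; simp only [Finset.mem_insert, Finset.mem_Ico]; omega
    have e2 : Finset.Ico 0 (-(i : ℤ)) = ∅ := Finset.Ico_eq_empty (by omega)
    have e3 : Finset.Ico 0 (-(i : ℤ) - 1) = ∅ := Finset.Ico_eq_empty (by omega)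
    rw [e2, Finset.sum_empty] at ih
    rw [e1, e3, Finset.sum_empty, Finset.sum_insert (by simp), sub_add_cancel]
    linarith

theorem nextBand_pathBand {n : ℕ} (b : Fin n → ℤ) (d : Fin n) (j : ℤ) :
    nextBand (pathBand b d j) d = pathBand b d (j + 1) := by
  funext i
  by_cases hi : i = d
  · subst hi; simp [nextBand, pathBand]
  · simp [nextBand, pathBand, hi]

/-- Increments telescope along the path of bands from `0` to `b`. -/
theorem sum_pathBand {n : ℕ} (φ : (Fin n → ℤ) → ℝ) (J : (Fin n → ℤ) → Fin n → ℝ)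
    (hJ : ∀ b d, J b d = φ (nextBand b d) - φ b) (b : Fin n → ℤ) :
    ∑ d, (∑ j ∈ Finset.Ico 0 (b d), J (pathBand b d j) d -
      ∑ j ∈ Finset.Ico (b d) 0, J (pathBand b d j) d) = φ b - φ 0 := by
  simp only [hJ, nextBand_pathBand]
  rw [Finset.sum_congr rfl fun d _ => sum_Ico_sub_sum_Ico (fun j => φ (pathBand b d j)) (b d)]
  set P : ℕ → Fin n → ℤ := fun i e => if (e : ℕ) < i then b e else 0 with hP
  have h1 : ∀ d : Fin n, pathBand b d (b d) = P (d + 1) := by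
    intro d
    funext e
    rcases lt_trichotomy e d with h1 | rfl | h1
    · simp only [pathBand, hP, if_pos h1]
      rw [if_pos (by rw [Fin.lt_def] at h1; omega)]
    · simp [pathBand, hP]
    · simp only [pathBand, hP, if_neg h1.not_gt, if_neg h1.ne']
      rw [if_neg (by rw [Fin.lt_def] at h1; omega)]
  have h2 : ∀ d : Fin n, pathBand b d 0 = P d := by
    intro d
    funext e
    simp only [pathBand, hP, Fin.lt_def]
    split_ifs <;> rfl
  simp only [h1, h2]
  rw [Fin.sum_univ_eq_sum_range (fun i => φ (P (i + 1)) - φ (P i)) n,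
    Finset.sum_range_sub fun i => φ (P i)]
  congr 2
  · funext e
    simp [hP]

variable {n N : ℕ} {Ω T : Fin (n + 1) → ℝ} {M lam h B K δ : ℝ} {NB : Fin n → ℕ}
  {g : (Fin (n + 1) → ℝ) → ℝ} {y : (Fin (n + 1) → ℤ) → ℝ}

theorem FoldRegular.foldResidual_zero {b : Fin n → ℤ} (H : FoldRegular lam h B g b K δ) :
    foldResidual lam h B g b 0 = h * (bandConst lam h B g b : ℝ) := by
  have hpos : ∀ r < foldCount lam h B g b, 0 < (foldState lam h B g b (r + 1)).time := by
    intro r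
    induction r with
    | zero =>
      intro hr
      have := H.add_lt_time_succ (G := 0) (by rw [zero_mul]; exact H.h_pos) hr
      have h0 : (foldState lam h B g b 0).time = 0 := rfl
      linarith
    | succ r ih =>
      intro hr
      have h1 := ih (by omega)
      have h2 := H.add_lt_time_succ (G := 0) (by rw [zero_mul]; exact H.h_pos) hr
      linarith
  rw [foldResidual_eq, Finset.sum_eq_zero, add_zero]
  intro r hr
  rw [if_neg (not_le.mpr (hpos r (Finset.mem_range.mp hr))), mul_zero]

/-- The lines of the filter `bandFilter`, represented by their points with `k_d = 0`. -/
def bandLines (NB : Fin n → ℕ) (b : Fin n → ℤ) (d : Fin n) : Finset (Fin (n + 1) → ℤ) :=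
  Fintype.piFinset (Fin.cons {0} fun d' => if d' = d then {0} else
    Finset.Ico (b d' * NB d') ((b d' + 1) * NB d') : Fin (n + 1) → Finset ℤ)

theorem mem_bandLines {b : Fin n → ℤ} {d : Fin n} {p : Fin (n + 1) → ℤ} :
    p ∈ bandLines NB b d ↔ p 0 = 0 ∧ p d.succ = 0 ∧
      ∀ d', d' ≠ d → p d'.succ ∈ Finset.Ico (b d' * NB d') ((b d' + 1) * NB d') := by
  rw [bandLines, Fintype.mem_piFinset, Fin.forall_fin_succ]
  simp only [Fin.cons_zero, Fin.cons_succ, Finset.mem_singleton]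
  refine and_congr_right fun _ => ⟨fun H => ⟨by simpa using H d, fun d' hd' => ?_⟩, ?_⟩
  · have := H d'
    rwa [if_neg hd'] at this
  · rintro ⟨H1, H2⟩ d'
    by_cases hd' : d' = d
    · subst hd'; simpa using H1
    · rw [if_neg hd']
      exact H2 d' hd'

theorem card_bandLines (NB : Fin n → ℕ) (b : Fin n → ℤ) (d : Fin n) :
    ((bandLines NB b d).card : ℝ) = ∏ d' ∈ Finset.univ.erase d, (NB d' : ℝ) := by
  rw [bandLines, Fintype.card_piFinset, Fin.prod_univ_succ]
  simp only [Fin.cons_zero, Fin.cons_succ, Finset.card_singleton, one_mul, Nat.cast_prod]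
  rw [← Finset.mul_prod_erase _ _ (Finset.mem_univ d), if_pos rfl, Finset.card_singleton,
    Nat.cast_one, one_mul]
  refine Finset.prod_congr rfl fun d' hd' => ?_
  rw [if_neg (Finset.ne_of_mem_erase hd'), Int.card_Ico]
  simp [← sub_mul]

/-- Because `N` is less than the number of samples in a band, the support of the difference filter
does not reach beyond the two bands. -/
theorem seqInner_bandFilter (hT : ∀ d, 0 < T d) (hNB : ∀ d, B / T d.succ = (NB d : ℝ))
    (hNB0 : ∀ d, N < NB d) (y : (Fin (n + 1) → ℤ) → ℝ) (b : Fin n → ℤ) (d : Fin n) :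
    seqInner y (bandFilter T B NB N b d) =
      (∑ p ∈ bandLines NB b d, (fwdDiff 1)^[N] (fun j => y (Function.update p d.succ j))
        ((NB d : ℤ) * (b d + 1) - 1)) / ∏ d' ∈ Finset.univ.erase d, (NB d' : ℝ) := by
  refine seqInner_eq_sum_fwdDiff d.succ _ (fun p hp => (mem_bandLines.mp hp).2.1) N _ _ y _
    fun k => ?_
  have hnext : nextBand b d d = b d + 1 := by simp [nextBand]
  have hmem : Function.update k d.succ 0 ∈ bandLines NB b d ↔ k 0 = 0 ∧
      ∀ d', d' ≠ d → k d'.succ ∈ Finset.Ico (b d' * NB d') ((b d' + 1) * NB d') := by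
    rw [mem_bandLines, Function.update_self, Function.update_of_ne (Fin.succ_ne_zero d).symm]
    simp only [true_and]
    refine and_congr_right fun _ => forall₂_congr fun d' hd' => ?_
    rw [Function.update_of_ne (by simpa using hd')]
  have hunion : sampleTail T k ∈ band B b ∪ band B (nextBand b d) ↔
      (∀ d', d' ≠ d → k d'.succ ∈ Finset.Ico (b d' * NB d') ((b d' + 1) * NB d')) ∧
        k d.succ ∈ Finset.Ico (b d * NB d) ((b d + 2) * NB d) := by
    rw [Set.mem_union, sampleTail_mem_band hT hNB, sampleTail_mem_band hT hNB]
    have hne : ∀ d', d' ≠ d → nextBand b d d' = b d' := fun d' hd' => by simp [nextBand, hd']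
    have hN0 : (0 : ℤ) ≤ NB d := by positivity
    constructor
    · rintro (H | H)
      · refine ⟨fun d' _ => H d', ?_⟩
        have := H d
        rw [Finset.mem_Ico] at this ⊢
        constructor <;> nlinarith
      · refine ⟨fun d' hd' => by simpa [hne d' hd'] using H d', ?_⟩
        have := H d
        rw [hnext, Finset.mem_Ico] at this
        rw [Finset.mem_Ico]
        constructor <;> nlinarith
    · rintro ⟨H1, H2⟩
      rw [Finset.mem_Ico] at H2
      rcases lt_or_ge (k d.succ) ((b d + 1) * NB d) with hlt | hge
      · left
        intro d'
        by_cases hd' : d' = d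
        · subst hd'
          exact Finset.mem_Ico.mpr ⟨H2.1, hlt⟩
        · exact H1 d' hd'
      · right
        intro d'
        by_cases hd' : d' = d
        · subst hd'
          rw [hnext, Finset.mem_Ico]
          exact ⟨hge, by linarith [H2.2]⟩
        · rw [hne d' hd']
          exact H1 d' hd'
  rw [bandFilter, hnext]
  by_cases h1 : k 0 = 0 ∧ sampleTail T k ∈ band B b ∪ band B (nextBand b d)
  · rw [if_pos h1, if_pos (hmem.mpr ⟨h1.1, (hunion.mp h1.2).1⟩)]
  · rw [if_neg h1]
    split_ifs with h2
    · obtain ⟨h3, h4⟩ := hmem.mp h2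
      rw [diffCoeff_eq_zero, zero_div]
      by_contra! hcon
      refine h1 ⟨h3, hunion.mpr ⟨h4, ?_⟩⟩
      rw [Finset.mem_Ico]
      have h5 : (N : ℤ) < NB d := by exact_mod_cast hNB0 d
      constructor <;> nlinarith
    · rfl

/-- The thresholded filter output is the jump of the band constant: the filter sees a single step,
of height `h` times the jump, with weight `(-1) ^ (N - 1)`. -/
theorem BernsteinClass.bandJump_eq (hg : BernsteinClass Ω M g)
    (hΩ : ∀ d, 0 < Ω d) (hT : ∀ d, 0 < T d) (hB : 0 < B)
    (hNB : ∀ d, B / T d.succ = (NB d : ℝ)) (hNB0 : ∀ d, N < NB d) (hN : 1 ≤ N)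
    (h1 : M * B * ∑ d : Fin n, Ω d.succ < min (h / 2) (2 * lam - 3 * h))
    (h2 : ∀ d, (T d * Ω d) ^ N * M < h / 2)
    (hy : ∀ k, 0 ≤ k 0 → y k = foldHalf lam h B g (sampleCoord T k)) (b : Fin n → ℤ)
    (d : Fin n) :
    bandJump h B T NB N y b d =
      (bandConst lam h B g (nextBand b d) : ℝ) - (bandConst lam h B g b : ℝ) := by
  have hh := (hg.foldRegular hΩ hB h1 b).h_pos
  have hjump := hg.abs_bandConst_sub_le hΩ hB h1 b d
  set D : ℤ := bandConst lam h B g (nextBand b d) - bandConst lam h B g b with hD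
  have hDR : (bandConst lam h B g (nextBand b d) : ℝ) - (bandConst lam h B g b : ℝ) = (D : ℝ) := by
    rw [hD]; push_cast; ring
  rw [hDR]
  set m : ℤ := (NB d : ℤ) * (b d + 1) - 1 with hm
  have hval : ∀ (k : Fin (n + 1) → ℤ) (b' : Fin n → ℤ), k 0 = 0 →
      (∀ d', k d'.succ ∈ Finset.Ico (b' d' * NB d') ((b' d' + 1) * NB d')) →
      y k = g (sampleCoord T k) - h * (bandConst lam h B g b' : ℝ) := by
    intro k b' hk0 hk
    rw [hy k hk0.ge, foldHalf_sample (b := b') hB ((sampleTail_mem_band hT hNB k b').mpr hk), hk0,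
      Int.cast_zero, mul_zero, (hg.foldRegular hΩ hB h1 b').foldResidual_zero]
  have hC0 : 0 < ∏ d' ∈ Finset.univ.erase d, (NB d' : ℝ) :=
    Finset.prod_pos fun d' _ => Nat.cast_pos.mpr (by have := hNB0 d'; omega)
  have hline : ∀ p ∈ bandLines NB b d,
      |(fwdDiff 1)^[N] (fun j => y (Function.update p d.succ j)) m - h * D * (-1) ^ N| ≤
        (T d.succ * Ω d.succ) ^ N * M := by
    intro p hp
    obtain ⟨hp0, -, hp2⟩ := mem_bandLines.mp hp
    set ρ : ℤ → ℝ :=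
      h • ((fun _ => (bandConst lam h B g b : ℝ)) + (D : ℝ) • unitStep (m + 1)) with hρ
    have hcongr : (fwdDiff 1)^[N] (fun j => y (Function.update p d.succ j)) m =
        (fwdDiff 1)^[N] (fun j => g (sampleCoord T (Function.update p d.succ j)) -
          ρ j) m := by
      refine fwdDiff_iter_congr N m fun j hj1 hj2 => ?_
      have hNd : (N : ℤ) < NB d := by exact_mod_cast hNB0 d
      have hN1 : (1 : ℤ) ≤ N := by exact_mod_cast hN
      have hk0 : Function.update p d.succ j 0 = 0 := by
        rw [Function.update_of_ne (Fin.succ_ne_zero d).symm, hp0]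
      simp only [hρ, Pi.smul_apply, Pi.add_apply, smul_eq_mul, unitStep]
      rcases eq_or_lt_of_le hj1 with rfl | hlt
      · rw [hval _ b hk0, if_neg (by omega), mul_zero, add_zero]
        intro d'
        by_cases hd' : d' = d
        · subst hd'
          rw [Function.update_self, Finset.mem_Ico, hm]
          constructor <;> nlinarith
        · rw [Function.update_of_ne (by simpa using hd')]
          exact hp2 d' hd'
      · rw [hval _ (nextBand b d) hk0, if_pos (by omega), mul_one, ← hDR, add_sub_cancel]
        intro d'
        by_cases hd' : d' = d
        · subst hd'
          have hnext : nextBand b d' d' = b d' + 1 := by simp [nextBand]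
          rw [Function.update_self, hnext, Finset.mem_Ico]
          constructor <;> nlinarith
        · rw [Function.update_of_ne (by simpa using hd')]
          simpa [nextBand, hd'] using hp2 d' hd'
    have hstep : (fwdDiff 1)^[N] ρ m = -(h * D * (-1) ^ N) := by
      obtain ⟨N', rfl⟩ := Nat.exists_eq_add_of_le' hN
      rw [hρ, fwdDiff_iter_const_smul, fwdDiff_iter_add, fwdDiff_iter_const_smul, Pi.smul_apply,
        Pi.add_apply, fwdDiff_iter_const, zero_add, Pi.smul_apply, fwdDiff_iter_unitStep_pred,
        smul_eq_mul, smul_eq_mul, pow_succ]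
      ring
    rw [hcongr, fwdDiff_iter_sub, hstep, sub_neg_eq_add, add_sub_cancel_right]
    exact hg.abs_fwdDiff_sample_le hT N p d.succ m
  obtain ⟨w, hw, he⟩ := exists_average_eq_add _ (card_bandLines NB b d) hC0 _ hline
  obtain ⟨hw1, hw2⟩ := abs_lt.mp (hw.trans_lt (h2 d.succ))
  rw [bandJump, seqInner_bandFilter hT hNB hNB0, ← hm, he]
  have hDcases : D = 0 ∨ D = 1 ∨ D = -1 := by
    rw [abs_le] at hjump
    omega
  rcases hDcases with hD0 | hD0
  · rw [hD0]
    simp only [Int.cast_zero, mul_zero, zero_mul, add_zero]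
    rw [if_neg]
    rw [not_le, abs_lt]
    exact ⟨hw1, hw2⟩
  · have hDN : ∃ σ : ℝ, (σ = 1 ∨ σ = -1) ∧ (D : ℝ) * (-1) ^ N = σ ∧ (D : ℝ) = (-1) ^ N * σ := by
      refine ⟨D * (-1) ^ N, ?_, rfl, ?_⟩
      · rcases neg_one_pow_eq_or ℝ N with h3 | h3 <;> rcases hD0 with h4 | h4 <;> rw [h3, h4] <;>
          simp
      · rw [mul_left_comm, ← mul_pow]
        simp
    obtain ⟨σ, hσ, hσ1, hσ2⟩ := hDN
    rw [mul_assoc, hσ1, hσ2]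
    rcases hσ with rfl | rfl
    · rw [if_pos (by rw [le_abs]; left; linarith), Real.sign_of_pos (by linarith)]
    · rw [if_pos (by rw [le_abs]; right; linarith), Real.sign_of_neg (by linarith)]

theorem BernsteinClass.bandConstEst_eq (hg : BernsteinClass Ω M g)
    (hΩ : ∀ d, 0 < Ω d) (hT : ∀ d, 0 < T d) (hB : 0 < B)
    (hNB : ∀ d, B / T d.succ = (NB d : ℝ)) (hNB0 : ∀ d, N < NB d) (hN : 1 ≤ N)
    (h1 : M * B * ∑ d : Fin n, Ω d.succ < min (h / 2) (2 * lam - 3 * h))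
    (h2 : ∀ d, (T d * Ω d) ^ N * M < h / 2)
    (hy : ∀ k, 0 ≤ k 0 → y k = foldHalf lam h B g (sampleCoord T k)) (b : Fin n → ℤ) :
    bandConstEst h B T NB N y b =
      (bandConst lam h B g b : ℝ) - (bandConst lam h B g 0 : ℝ) :=
  sum_pathBand (fun b => (bandConst lam h B g b : ℝ)) _
    (hg.bandJump_eq hΩ hT hB hNB hNB0 hN h1 h2 hy) b

end BandConstants

/-! ### The reconstruction theorem -/

section Reconstruction

variable {n : ℕ} {V : Matrix (Fin (n + 1)) (Fin (n + 1)) ℝ} {lam h B : ℝ} {f : Space n → ℝ}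
  {T : Fin (n + 1) → ℝ} {y : (Fin (n + 1) → ℤ) → ℝ}

theorem samplePoint_eq (V : Matrix (Fin (n + 1)) (Fin (n + 1)) ℝ) (T : Fin (n + 1) → ℝ)
    (k : Fin (n + 1) → ℤ) : samplePoint V T k = latticePoint V (sampleCoord T k) := by
  rw [samplePoint]
  congr 1
  funext d
  rw [Matrix.mulVec_diagonal, sampleCoord]

theorem moduloHysteresis_samplePoint (hV : IsUnit V.det) (k : Fin (n + 1) → ℤ) :
    moduloHysteresis V lam h B f (samplePoint V T k) =
      foldLattice lam h B (fun x => f (latticePoint V x)) (sampleCoord T k) := by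
  rw [samplePoint_eq, moduloHysteresis]
  congr 1
  simp [latticePoint, Matrix.mulVec_mulVec, Matrix.nonsing_inv_mul V hV]

theorem reflect_sampleCoord (k : Fin (n + 1) → ℤ) :
    reflect (sampleCoord T k) = sampleCoord T (reflect k) := by
  funext d
  refine Fin.cases ?_ (fun d => ?_) d
  · simp [reflect, sampleCoord]
  · simp [reflect, sampleCoord, Fin.tail]

theorem reflect_reflect {R : Type} [InvolutiveNeg R] (x : Fin (n + 1) → R) :
    reflect (reflect x) = x := by
  simp [reflect]

/-- The constants only depend on the input on `x₁ = 0`, which the reflection fixes. -/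
theorem bandConst_reflect (g : (Fin (n + 1) → ℝ) → ℝ) (b : Fin n → ℤ) :
    bandConst lam h B (fun x => g (reflect x)) b = bandConst lam h B g b := by
  simp [bandConst, reflect]

end Reconstruction

end ModuloHysteresis

end

theorem theorem2 {n : ℕ} (V : Matrix (Fin (n + 1)) (Fin (n + 1)) ℝ)
    (hV : LinearIndependent ℝ V.col) (hV1 : ∀ d, ‖WithLp.toLp 2 (V.col d)‖ = 1)
    (Ω T : Fin (n + 1) → ℝ) (hΩ : ∀ d, 0 < Ω d) (hT : ∀ d, 0 < T d)
    (lam h B : ℝ) (hB : 0 < B)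
    (NB : Fin n → ℕ) (hNB : ∀ d, B / T d.succ = (NB d : ℝ))
    (N : ℕ) (hN : 1 ≤ N)
    (f : ModuloHysteresis.Space n → ℝ) (hf : ModuloHysteresis.PaleyWiener V Ω f)
    (h1 : ModuloHysteresis.supNorm f * B * √((n + 1 : ℕ) : ℝ) * √(∑ d, Ω d ^ 2)
      < min (h / 2) (2 * lam - 3 * h))
    (h2 : ∀ d, (T d * Ω d * Real.exp 1) ^ N * ModuloHysteresis.supNorm f < h / 2)
    (h3 : ((N : ℝ) + 1) * T 0 * (Ω 0 * ModuloHysteresis.supNorm f) < h)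
    (h4 : ∀ d : Fin n, ((N : ℝ) + 1) * T d.succ < B)
    (y : (Fin (n + 1) → ℤ) → ℝ)
    (hy : ∀ k, y k =
      ModuloHysteresis.moduloHysteresis V lam h B f (ModuloHysteresis.samplePoint V T k)) :
    ModuloHysteresis.WellDefined V lam h B f ∧
    ∀ k, ModuloHysteresis.reconstruct h B T NB N y k =
      f (ModuloHysteresis.samplePoint V T k) -
        h * (ModuloHysteresis.bandConst lam h B
          (fun x => f (ModuloHysteresis.latticePoint V x)) 0 : ℝ) := by
  have hdet := ModuloHysteresis.isUnit_det_of_linearIndependent_col hV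
  set M := ModuloHysteresis.supNorm f with hM
  set g : (Fin (n + 1) → ℝ) → ℝ := fun x => f (ModuloHysteresis.latticePoint V x) with hgdef
  have hg : ModuloHysteresis.BernsteinClass Ω M g := hf.bernsteinClass hdet hΩ
  have hg' := hg.reflect
  have hM0 : 0 ≤ M := hg.bound_nonneg
  have hvar : M * B * ∑ d : Fin n, Ω d.succ < min (h / 2) (2 * lam - 3 * h) := by
    refine lt_of_le_of_lt ?_ h1
    rw [mul_assoc (M * B)]
    exact mul_le_mul_of_nonneg_left
      (ModuloHysteresis.BernsteinClass.sum_bandwidth_le Ω (hΩ 0).le) (by positivity)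
  have hdiff : ∀ d, (T d * Ω d) ^ N * M < h / 2 := by
    intro d
    refine lt_of_le_of_lt ?_ (h2 d)
    have h5 : 0 ≤ T d * Ω d := mul_nonneg (hT d).le (hΩ d).le
    have h6 : T d * Ω d ≤ T d * Ω d * Real.exp 1 :=
      le_mul_of_one_le_right h5 (Real.one_le_exp zero_le_one)
    gcongr
  have hNB0 : ∀ d, N < NB d := by
    intro d
    have h5 := h4 d
    rw [← lt_div_iff₀ (hT d.succ), hNB] at h5
    have h6 : N + 1 < NB d := by exact_mod_cast h5
    omega
  have hNB1 : ∀ d, 0 < NB d := fun d => by have := hNB0 d; omega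
  refine ⟨fun b => ⟨(hg.foldRegular hΩ hB hvar b).exists_foldsEnd,
    (hg'.foldRegular hΩ hB hvar b).exists_foldsEnd⟩, fun k => ?_⟩
  have hyl : ∀ k, y k = ModuloHysteresis.foldLattice lam h B g
      (ModuloHysteresis.sampleCoord T k) := fun k => by
    rw [hy, ModuloHysteresis.moduloHysteresis_samplePoint hdet]
  have hsgn : ∀ k : Fin (n + 1) → ℤ,
      0 ≤ ModuloHysteresis.sampleCoord T k 0 ↔ 0 ≤ k 0 := fun k => by
    rw [ModuloHysteresis.sampleCoord, mul_nonneg_iff_of_pos_left (hT 0), Int.cast_nonneg_iff]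
  have hyp : ∀ k, 0 ≤ k 0 → y k = ModuloHysteresis.foldHalf lam h B g
      (ModuloHysteresis.sampleCoord T k) := by
    intro k hk
    rw [hyl, ModuloHysteresis.foldLattice, if_pos ((hsgn k).mpr hk)]
  have hyn : ∀ k : Fin (n + 1) → ℤ, k 0 < 0 → y k = ModuloHysteresis.foldHalf lam h B
      (fun x => g (ModuloHysteresis.reflect x))
      (ModuloHysteresis.sampleCoord T (ModuloHysteresis.reflect k)) := by
    intro k hk
    rw [hyl, ModuloHysteresis.foldLattice, if_neg (mt (hsgn k).mp (not_le.mpr hk)),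
      ModuloHysteresis.reflect_sampleCoord]
  set b := ModuloHysteresis.bandIndex B (ModuloHysteresis.sampleTail T k) with hb
  have hkb : ModuloHysteresis.sampleTail T k ∈ ModuloHysteresis.band B b :=
    ModuloHysteresis.mem_band_bandIndex hB _
  have hconst := hg.bandConstEst_eq hΩ hT hB hNB hNB0 hN hvar hdiff hyp b
  rw [ModuloHysteresis.reconstruct, ModuloHysteresis.samplePoint_eq]
  rw [← hb, hconst]
  by_cases hk : 0 ≤ k 0
  · have hfold := hg.foldResidual_eq_foldSumEst hΩ hT hB hNB hNB1 hN hvar (hdiff 0) h3 hyp b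
      (k 0).natAbs
    rw [Int.natAbs_of_nonneg hk] at hfold
    rw [if_pos hk, hyp k hk, ModuloHysteresis.foldHalf_sample hB hkb, hfold]
    ring
  · have hk' : k 0 < 0 := not_le.mp hk
    have hyr : ∀ k : Fin (n + 1) → ℤ, 0 ≤ k 0 → y (ModuloHysteresis.reflect k) =
        ModuloHysteresis.foldHalf lam h B (fun x => g (ModuloHysteresis.reflect x))
          (ModuloHysteresis.sampleCoord T k) := by
      intro k hk
      rcases hk.eq_or_lt with h0 | hpos
      · -- on the hyperplane `k₁ = 0` both half-spaces give `M_b`, as no fold happens at time `0`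
        have hrk : ModuloHysteresis.reflect k = k := by
          rw [ModuloHysteresis.reflect, ← h0, neg_zero, h0, Fin.cons_self_tail]
        have hmem := ModuloHysteresis.mem_band_bandIndex hB (ModuloHysteresis.sampleTail T k)
        rw [hrk, hyp k hk, ModuloHysteresis.foldHalf_sample hB hmem,
          ModuloHysteresis.foldHalf_sample hB hmem, ← h0, Int.cast_zero, mul_zero,
          (hg.foldRegular hΩ hB hvar _).foldResidual_zero,
          (hg'.foldRegular hΩ hB hvar _).foldResidual_zero, ModuloHysteresis.bandConst_reflect,
          ModuloHysteresis.reflect_sampleCoord, hrk]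
      · rw [hyn _ (by simpa [ModuloHysteresis.reflect] using hpos),
          ModuloHysteresis.reflect_reflect]
    have hfold := hg'.foldResidual_eq_foldSumEst hΩ hT hB hNB hNB1 hN hvar (hdiff 0) h3 hyr b
      (k 0).natAbs
    have habs : ((k 0).natAbs : ℤ) = ModuloHysteresis.reflect k 0 := by
      simp only [ModuloHysteresis.reflect, Fin.cons_zero]
      omega
    rw [habs, ModuloHysteresis.bandConst_reflect] at hfold
    have hkb' : ModuloHysteresis.sampleTail T (ModuloHysteresis.reflect k) ∈
        ModuloHysteresis.band B b := hkb
    rw [if_neg hk, hyn k hk', ModuloHysteresis.foldHalf_sample hB hkb', hfold,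
      ← ModuloHysteresis.reflect_sampleCoord, ModuloHysteresis.reflect_reflect]
    ring
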